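/- **Setting.** The Links–Gould polynomial $\mathrm{LG}(L;t_0,t_1)\in\mathbb Z[t_0^{\pm1},t_1^{\pm1}]$ of a link $L$ is the modified Reshetikhin–Turaev invariant of the Links–Gould $R$-matrix: let $W$ have basis $w_1,\dots,w_4$ over an extension of $\mathbb Q(t_0,t_1)$ containing $t_0^{1/2}$, $t_1^{1/2}$ and $Y=\sqrt{(t_0-1)(1-t_1)}$; write $w_{ij}=w_i\otimes w_j$, and let $R(w_{ij})$ be the $(i,j)$ entry of $$\begin{pmatrix} t_0 w_{11} & t_0^{1/2}w_{21} & t_0^{1/2}w_{31} & w_{41}\\ t_0^{1/2}w_{12}+(t_0-1)w_{21} & -w_{22} & (t_0t_1-1)w_{23}-t_0^{1/2}t_1^{1/2}w_{32}-t_0^{1/2}t_1^{1/2}Yw_{41} & t_1^{1/2}w_{42}\\ t_0^{1/2}w_{13}+(t_0-1)w_{31} & -t_0^{1/2}t_1^{1/2}w_{23}+Yw_{41} & -w_{33} & t_1^{1/2}w_{43}\\ w_{14}-t_0^{1/2}t_1^{1/2}Yw_{23}+Yw_{32}+Y^2w_{41} & t_1^{1/2}w_{24}+(t_1-1)w_{42}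 & t_1^{1/2}w_{34}+(t_1-1)w_{43} & t_1w_{44}\end{pmatrix}$$ and $h=\mathrm{diag}(t_0^{-1},-t_1,-t_0^{-1},t_1)$. Diagrams are read from bottom to top. A positive crossing of two upward strands (the strand from bottom left to top right is over) is sent to $R$, a negative one to $R^{-1}$, the maxima to $W\otimes W^*\to\mathbb K$, $x\otimes f\mapsto f(hx)$, and $W^*\otimes W\to\mathbb K$, $f\otimes x\mapsto f(x)$, and the minima to the corresponding dual copairings $1\mapsto\sum_i w_i\otimes w_i^*$ and $1\mapsto\sum_i w_i^*\otimes h^{-1}w_i$. If $L$ is cut open to a $(1,1)$-tangle $L^{\mathrm{cut}}$, then $F_{L^{\mathrm{cut}}}=\mathrm{LG}(L)\cdot\mathrm{id}_W$. For $n\in\mathbb Z$ let $K_n$ be the twist knot given by the standard diagram with a clasp of two negative crossings and a vertical twist region of two antiparallel strands with $2n-1$ half twists. If $2n-1>0$, the strand from bottom left to top right is over at each crossing of the twist region, so that these crossings are negative; if $2n-1<0$, the twist region has $1-2n$ crossings of the opposite sort. Thus $K_0$ is the unknot, $K_1$ the left-handed trefoil and $K_{-1}$ the figure-eight knot. Every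 twist knot is some $K_n$ or its mirror image. A real two-indexed sequence $(a_{ij})_{i,j\in\mathbb Z}$ with support $S=\{(i,j):a_{ij}\ne0\}$ has *no interior zeros* if $\mathrm{Conv}(S)\cap\mathbb Z^2=S$. It is *2d log-concave* if $a_{i+k,j+l}\,a_{i-k,j-l}\le a_{ij}^2$ for all $i,j,k,l\in\mathbb Z$. It is *unimodal* if for every real $c\ge0$ the sequence $(a_{ij}\mathbf 1_{|a_{ij}|\ge c})_{i,j}$ has no interior zeros. **Proposition.** (a) $\mathrm{LG}(K_0)=1$. (b) For $l\ge1$, $$\begin{aligned}\mathrm{LG}(K_{-l})={}&1+(2-t_0-t_1-t_0^{-1}-t_1^{-1}+t_0t_1+t_0^{-1}t_1^{-1})\sum_{k=0}^{l-1}(t_0t_1)^k\\&+(4-2t_0-2t_1-2t_0^{-1}-2t_1^{-1}+t_0t_1+t_0^{-1}t_1^{-1}+t_0t_1^{-1}+t_0^{-1}t_1)\sum_{k=0}^{l-1}(2l-2k-1)(t_0t_1)^k.\end{aligned}$$ (c) For $n\ge1$, $$\begin{aligned}\mathrm{LG}(K_n;t_0^{-1},t_1^{-1})={}&(t_0t_1)^{n-1}(-t_0^2t_1-t_0t_1^2+t_0^2+t_1^2+2t_0t_1-t_0-t_1+1)\\&+(t_0^2t_1^2-3t_0^2t_1-3t_0t_1^2+2t_0^2+2t_1^2+5t_0t_1-3t_0-3t_1+2)\sum_{k=0}^{n-2}(t_0t_1)^k\\&+(t_0^2t_1^2-2t_0^2t_1-2t_0t_1^2+t_0^2+t_1^2+4t_0t_1-2t_0-2t_1+1)\sum_{k=0}^{n-2}(2n-2k-3)(t_0t_1)^k.\end{aligned}$$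 (d) For every twist knot $K$, that is, for $K=K_n$ with $n\in\mathbb Z$ and for the mirror image of $K_n$, write $\mathrm{LG}(K)=\sum a_{ij}t_0^it_1^j$. Then $a_{ij}=(-1)^{i+j}|a_{ij}|$ for all $i,j$, and $(a_{ij})$ has no interior zeros. The sequence $(|a_{ij}|)$ is 2d log-concave with no interior zeros, and it is unimodal. -/

import Mathlib

/-! ### Oriented tangle diagrams and the Reshetikhin-Turaev functor -/

/-- Orientation of a strand at a boundary point: `up` is coloured by `W`, `down` by its dual. -/
inductive Dir where
  | up
  | down

open Dir

/-- Oriented tangle diagrams, built from the elementary ones by vertical and horizontal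
composition. Diagrams are read from bottom to top: `Tangle u v` has bottom boundary `u` and top
boundary `v`, both listed from left to right. -/
inductive Tangle : List Dir → List Dir → Type where
  /-- parallel vertical strands -/
  | strands (w : List Dir) : Tangle w w
  /-- positive crossing: the strand from bottom left to top right is over -/
  | cross : Tangle [up, up] [up, up]
  /-- negative crossing: the strand from bottom right to top left is over -/
  | crossInv : Tangle [up, up] [up, up]
  /-- a maximum, traversed from left to right -/
  | capUpDown : Tangle [up, down] []
  /-- a maximum, traversed from right to left -/
  | capDownUp : Tangle [down, up] []
  /-- a minimum, traversed from right to left -/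
  | cupUpDown : Tangle [] [up, down]
  /-- a minimum, traversed from left to right -/
  | cupDownUp : Tangle [] [down, up]
  /-- `stack S T` puts `T` on top of `S` -/
  | stack {u v w : List Dir} (S : Tangle u v) (T : Tangle v w) : Tangle u w
  /-- `beside S T` puts `T` to the right of `S` -/
  | beside {a b c d : List Dir} (S : Tangle a b) (T : Tangle c d) : Tangle (a ++ c) (b ++ d)

namespace Tangle

/-- The mirror image of a diagram: all crossings are changed. -/
def mirror : {u v : List Dir} → Tangle u v → Tangle u v
  | _, _, strands w => strands w
  | _, _, cross => crossInv
  | _, _, crossInv => cross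
  | _, _, capUpDown => capUpDown
  | _, _, capDownUp => capDownUp
  | _, _, cupUpDown => cupUpDown
  | _, _, cupDownUp => cupDownUp
  | _, _, stack S T => stack S.mirror T.mirror
  | _, _, beside S T => beside S.mirror T.mirror

end Tangle

/-- The index set of the standard basis of the tensor product attached to a boundary word, each
factor being a 4-dimensional space with basis `w₁, w₂, w₃, w₄` (indexed by `0, 1, 2, 3`), or the
dual of that space with the dual basis. -/
def Idx : List Dir → Type
  | [] => Unit
  | _ :: w => Fin 4 × Idx w

instance Idx.instFintype : (w : List Dir) → Fintype (Idx w)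
  | [] => inferInstanceAs (Fintype Unit)
  | _ :: w =>
    letI := Idx.instFintype w
    inferInstanceAs (Fintype (Fin 4 × Idx w))

instance Idx.instDecidableEq : (w : List Dir) → DecidableEq (Idx w)
  | [] => inferInstanceAs (DecidableEq Unit)
  | _ :: w =>
    letI := Idx.instDecidableEq w
    inferInstanceAs (DecidableEq (Fin 4 × Idx w))

/-- The part of a basis index that belongs to the left word. -/
def Idx.left : (a : List Dir) → {c : List Dir} → Idx (a ++ c) → Idx a
  | [], _, _ => ()
  | _ :: a, _, i => (i.1, Idx.left a i.2)

/-- The part of a basis index that belongs to the right word. -/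
def Idx.right : (a : List Dir) → {c : List Dir} → Idx (a ++ c) → Idx c
  | [], _, i => i
  | _ :: a, _, i => Idx.right a i.2

/-- The Reshetikhin-Turaev functor of an `R`-matrix `R` with a diagonal enhancement
`h = diag (h 0, …, h 3)`. The entry `(o, i)` of the matrix of a tangle is the coefficient of the
basis vector `o` in the image of the basis vector `i`. -/
noncomputable def reshetikhinTuraev {K : Type*} [Field K]
    (R : Matrix (Fin 4 × Fin 4) (Fin 4 × Fin 4) K) (h : Fin 4 → K) :
    {u v : List Dir} → Tangle u v → Matrix (Idx v) (Idx u) K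
  | _, _, .strands _ => 1
  | _, _, .cross => fun o i => R (o.1, o.2.1) (i.1, i.2.1)
  | _, _, .crossInv => fun o i => R⁻¹ (o.1, o.2.1) (i.1, i.2.1)
  | _, _, .capUpDown => fun _ i => if i.1 = i.2.1 then h i.1 else 0
  | _, _, .capDownUp => fun _ i => if i.1 = i.2.1 then 1 else 0
  | _, _, .cupUpDown => fun o _ => if o.1 = o.2.1 then 1 else 0
  | _, _, .cupDownUp => fun o _ => if o.1 = o.2.1 then (h o.1)⁻¹ else 0
  | _, _, .stack S T => reshetikhinTuraev R h T * reshetikhinTuraev R h S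
  | _, _, @Tangle.beside a b _ _ S T => fun o i =>
      reshetikhinTuraev R h S (Idx.left b o) (Idx.left a i) *
        reshetikhinTuraev R h T (Idx.right b o) (Idx.right a i)

/-! ### The Links-Gould polynomial -/

/-- The images of the basis vectors `w_i ⊗ w_j` under the Links-Gould `R`-matrix. The parameters
`s₀, s₁, Y` are square roots of `t₀`, `t₁` and `(t₀ - 1)(1 - t₁)`. Indices run from `0` to `3`, so
that `w 0 0` stands for the vector that is usually written `w₁₁`. -/
def linksGouldImage {K : Type*} [Field K] (s₀ s₁ Y : K) :
    Fin 4 → Fin 4 → (Fin 4 × Fin 4 → K) :=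
  let t₀ := s₀ ^ 2
  let t₁ := s₁ ^ 2
  let w : Fin 4 → Fin 4 → (Fin 4 × Fin 4 → K) := fun i j => Pi.single (i, j) 1
  ![![t₀ • w 0 0,
      s₀ • w 1 0,
      s₀ • w 2 0,
      w 3 0],
    ![s₀ • w 0 1 + (t₀ - 1) • w 1 0,
      -w 1 1,
      (t₀ * t₁ - 1) • w 1 2 - (s₀ * s₁) • w 2 1 - (s₀ * s₁ * Y) • w 3 0,
      s₁ • w 3 1],
    ![s₀ • w 0 2 + (t₀ - 1) • w 2 0,
      -((s₀ * s₁) • w 1 2) + Y • w 3 0,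
      -w 2 2,
      s₁ • w 3 2],
    ![w 0 3 - (s₀ * s₁ * Y) • w 1 2 + Y • w 2 1 + Y ^ 2 • w 3 0,
      s₁ • w 1 3 + (t₁ - 1) • w 3 1,
      s₁ • w 2 3 + (t₁ - 1) • w 3 2,
      t₁ • w 3 3]]

/-- The Links-Gould `R`-matrix. -/
def linksGouldR {K : Type*} [Field K] (s₀ s₁ Y : K) :
    Matrix (Fin 4 × Fin 4) (Fin 4 × Fin 4) K :=
  fun o i => linksGouldImage s₀ s₁ Y i.1 i.2 o

/-- The (diagonal) Links-Gould enhancement. -/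
def linksGouldH {K : Type*} [Field K] (s₀ s₁ : K) : Fin 4 → K :=
  ![(s₀ ^ 2)⁻¹, -s₁ ^ 2, -(s₀ ^ 2)⁻¹, s₁ ^ 2]

/-- The ring `ℤ[t₀^{±1}, t₁^{±1}]`. The coefficient of `t₀ ^ i * t₁ ^ j` in `P` is
`P.coeff (i, j)`. -/
abbrev LaurentTwo : Type := AddMonoidAlgebra ℤ (ℤ × ℤ)

/-- The value of a Laurent polynomial at `(x₀, x₁)`. -/
noncomputable def LaurentTwo.eval {K : Type*} [Field K] (x₀ x₁ : K) (P : LaurentTwo) : K :=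
  P.coeff.sum fun e c => (c : K) * (x₀ ^ e.1 * x₁ ^ e.2)

/-- The substitution `(t₀, t₁) ↦ (t₀⁻¹, t₁⁻¹)`. -/
noncomputable def LaurentTwo.invertVars (P : LaurentTwo) : LaurentTwo :=
  AddMonoidAlgebra.domCongr ℤ ℤ (AddEquiv.neg (ℤ × ℤ)) P

/-- The field of rational functions `ℚ(t₀, t₁)`. -/
abbrev RatTwo : Type := FractionRing (MvPolynomial (Fin 2) ℚ)

/-- An algebraic closure of `ℚ(t₀, t₁)`; it contains the square roots that the Links-Gould
`R`-matrix needs. -/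
abbrev LGField : Type := AlgebraicClosure RatTwo

/-- The variables `t₀` and `t₁` as elements of `LGField`. -/
noncomputable def tvar (i : Fin 2) : LGField :=
  algebraMap RatTwo LGField (algebraMap (MvPolynomial (Fin 2) ℚ) RatTwo (MvPolynomial.X i))

/-- The Laurent polynomial `P` is the Links-Gould polynomial of the link that is the closure of the
`(1, 1)`-tangle `T`: the Reshetikhin-Turaev functor maps `T` to `P` times the identity (whatever
square roots are used). -/
def IsLinksGould (T : Tangle [up] [up]) (P : LaurentTwo) : Prop :=
  ∀ s₀ s₁ Y : LGField, s₀ ^ 2 = tvar 0 → s₁ ^ 2 = tvar 1 →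
    Y ^ 2 = (tvar 0 - 1) * (1 - tvar 1) →
    reshetikhinTuraev (linksGouldR s₀ s₁ Y) (linksGouldH s₀ s₁) T =
      P.eval (tvar 0) (tvar 1) • (1 : Matrix (Idx [up]) (Idx [up]) LGField)

open Classical in
/-- The Links-Gould polynomial of the link that is the closure of a `(1, 1)`-tangle
(by convention `0` if the polynomial did not exist). -/
noncomputable def linksGould (T : Tangle [up] [up]) : LaurentTwo :=
  if h : ∃ P, IsLinksGould T P then h.choose else 0

/-! ### Twist knots -/

namespace Tangle

/-- A half twist of two antiparallel strands, the left one entering from below: the crossing `X`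
of two upward strands, rotated clockwise by a right angle. For `X = crossInv` the strand
from bottom left to top right is over. -/
def halfTwistUpDown (X : Tangle [up, up] [up, up]) : Tangle [up, down] [down, up] :=
  ((cupDownUp.beside (strands [up, down]) : Tangle [up, down] [down, up, up, down]).stack
    ((strands [down]).beside (X.beside (strands [down])))).stack
    ((strands [down, up]).beside capUpDown)

/-- A half twist of two antiparallel strands, the right one entering from below: the crossing `X`
of two upward strands, rotated counterclockwise by a right angle. For `X = crossInv` the
strand from bottom left to top right is over. -/
def halfTwistDownUp (X : Tangle [up, up] [up, up]) : Tangle [down, up] [up, down] :=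
  (((strands [down, up]).beside cupUpDown : Tangle [down, up] [down, up, up, down]).stack
    ((strands [down]).beside (X.beside (strands [down])))).stack
    (capDownUp.beside (strands [up, down]))

/-- `2 * k + 1` half twists of two antiparallel strands. -/
def oddTwist (X : Tangle [up, up] [up, up]) : ℕ → Tangle [up, down] [down, up]
  | 0 => halfTwistUpDown X
  | k + 1 => ((oddTwist X k).stack (halfTwistDownUp X)).stack (halfTwistUpDown X)

/-- The twist region with `2 * n - 1` half twists: the strands from bottom left to top right are
over if `2 * n - 1 > 0`, and there are `1 - 2 * n` crossings of the opposite sort if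
`2 * n - 1 < 0`. -/
def twistRegion (n : ℤ) : Tangle [up, down] [down, up] :=
  if 1 ≤ n then oddTwist crossInv (n - 1).toNat else oddTwist cross (-n).toNat

/-- The standard diagram of the twist knot `K_n`, cut open at its leftmost arc: the vertical twist
region with `2 * n - 1` half twists on the left, with its bottom right end turned up by a minimum;
next to it the clasp, two negative crossings of parallel upward strands; then a maximum joins the
left strand of the clasp to the top left end of the twist region. The closure of the
remaining two ends (the bottom left end of the twist region and the top right end of the clasp) is
`K_n`. -/
def twistKnot (n : ℤ) : Tangle [up] [up] :=
  (((((strands [up]).beside cupDownUp : Tangle [up] [up, down, up]).stack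
    ((twistRegion n).beside (strands [up]))).stack
    ((strands [down]).beside crossInv)).stack
    ((strands [down]).beside crossInv)).stack
    (capDownUp.beside (strands [up]))

end Tangle

/-! ### Properties of two-indexed sequences -/

/-- The support of a two-indexed sequence. -/
def supp (a : ℤ → ℤ → ℝ) : Set (ℤ × ℤ) := {p | a p.1 p.2 ≠ 0}

/-- The integer points in the convex hull of the support are exactly the points of the support. -/
def NoInteriorZeros (a : ℤ → ℤ → ℝ) : Prop :=
  {p : ℤ × ℤ | ((p.1 : ℝ), (p.2 : ℝ)) ∈
    convexHull ℝ ((fun q : ℤ × ℤ => ((q.1 : ℝ), (q.2 : ℝ))) '' supp a)} = supp a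

/-- The sign of `a i j` is `(-1) ^ (μ + i + j + 1)` wherever `a i j` is not zero. -/
def Alternates (μ : ℕ) (a : ℤ → ℤ → ℝ) : Prop :=
  ∀ i j : ℤ, a i j = (-1 : ℝ) ^ ((μ : ℤ) + i + j + 1) * |a i j|

/-- Log-concavity in all directions. -/
def TwoDLogConcave (a : ℤ → ℤ → ℝ) : Prop :=
  ∀ i j k l : ℤ, a (i + k) (j + l) * a (i - k) (j - l) ≤ a i j ^ 2

/-- All truncations of the sequence from below have no interior zeros. -/
def Unimodal (a : ℤ → ℤ → ℝ) : Prop :=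
  ∀ c : ℝ, 0 ≤ c → NoInteriorZeros fun i j => if c ≤ |a i j| then a i j else 0

/-- The sequence of coefficients of a Laurent polynomial. -/
def LaurentTwo.coeffSeq (P : LaurentTwo) (i j : ℤ) : ℝ := ((P.coeff (i, j) : ℤ) : ℝ)

/-- The sequence of absolute values of the coefficients of a Laurent polynomial. -/
def LaurentTwo.absSeq (P : LaurentTwo) (i j : ℤ) : ℝ := |P.coeffSeq i j|

/-- The monomial `t₀ ^ i * t₁ ^ j`. -/
noncomputable def LaurentTwo.mon (i j : ℤ) : LaurentTwo := AddMonoidAlgebra.single (i, j) 1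

/-- The explicit Laurent polynomial for `K_{-l}`, `l ≥ 1`. -/
noncomputable def twistValueNeg (l : ℕ) : LaurentTwo :=
  let t₀ := LaurentTwo.mon 1 0
  let t₁ := LaurentTwo.mon 0 1
  let u₀ := LaurentTwo.mon (-1) 0
  let u₁ := LaurentTwo.mon 0 (-1)
  1 + (2 - t₀ - t₁ - u₀ - u₁ + t₀ * t₁ + u₀ * u₁) * ∑ k ∈ Finset.range l, (t₀ * t₁) ^ k
    + (4 - 2 * t₀ - 2 * t₁ - 2 * u₀ - 2 * u₁ + t₀ * t₁ + u₀ * u₁ + t₀ * u₁ + u₀ * t₁)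
      * ∑ k ∈ Finset.range l, (2 * (l : LaurentTwo) - 2 * (k : LaurentTwo) - 1) * (t₀ * t₁) ^ k

/-- The explicit Laurent polynomial for `K_n`, `n ≥ 1`, in the inverted variables. -/
noncomputable def twistValuePosInv (n : ℕ) : LaurentTwo :=
  let t₀ := LaurentTwo.mon 1 0
  let t₁ := LaurentTwo.mon 0 1
  (t₀ * t₁) ^ (n - 1) *
      (-t₀ ^ 2 * t₁ - t₀ * t₁ ^ 2 + t₀ ^ 2 + t₁ ^ 2 + 2 * t₀ * t₁ - t₀ - t₁ + 1)
    + (t₀ ^ 2 * t₁ ^ 2 - 3 * t₀ ^ 2 * t₁ - 3 * t₀ * t₁ ^ 2 + 2 * t₀ ^ 2 + 2 * t₁ ^ 2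
        + 5 * t₀ * t₁ - 3 * t₀ - 3 * t₁ + 2)
      * ∑ k ∈ Finset.range (n - 1), (t₀ * t₁) ^ k
    + (t₀ ^ 2 * t₁ ^ 2 - 2 * t₀ ^ 2 * t₁ - 2 * t₀ * t₁ ^ 2 + t₀ ^ 2 + t₁ ^ 2
        + 4 * t₀ * t₁ - 2 * t₀ - 2 * t₁ + 1)
      * ∑ k ∈ Finset.range (n - 1),
          (2 * (n : LaurentTwo) - 2 * (k : LaurentTwo) - 3) * (t₀ * t₁) ^ k

/-!
The functor sees the twist region only through the powers of one operator on a space with basis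
indexed by pairs. Let `U` be the matrix of a half twist, which is the `R`-matrix (or its inverse)
rotated by a right angle, and let `M` be the matrix of a full twist, the product of the two
rotations. The twist region with `2 k + 1` crossings has the matrix `M ^ k U`. On the span of the
columns of `U` the operator `M` has the eigenvalue `1` with Jordan blocks of size at most two, and
one further eigenvalue `r`, which is `t₀ t₁` or its inverse: `(M - 1) ^ 2 (M - r) U = 0`. Hence
`M ^ k U` is a combination of `U`, `(M - 1) U` and `(M - 1) ^ 2 U` whose coefficients are `1`, `k`
and a double geometric sum (`iterate_eq_of_jordan`). Closing up with the clasp is linear in the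
matrix of the twist region, so three closures determine the polynomials of the whole family; each of
them is a scalar matrix, and the scalars match the explicit formulas (`double_sum_increment`,
`LGPoly.twist_closure`). Both sorts of crossings in the twist region and both sorts of clasps are
treated, which covers the mirror images; they replace `t₀`, `t₁` by their inverses.

The finitely many identities that this needs (an inverse of `R`, the relation for `M`, and the three
closures) hold in `ℤ[s₀^{±1}, s₁^{±1}, Y]` modulo `Y ^ 2 = (s₀ ^ 2 - 1) (1 - s₁ ^ 2)`. They are
checked by evaluation of sorted lists of terms in the kernel (`LGPoly.matR_mul_matRInv`,
`LGPoly.twistTests_matR`, `LGPoly.twistTests_matRInv`), and evaluation of such lists in a field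
transports them to matrices. A Laurent polynomial is determined by its value at the generic point
(`LaurentTwo.eval_tvar_injective`), so `linksGould` is the polynomial found.

The coefficients of the explicit polynomials form a chessboard of signs on the strip `|i - j| ≤ 2`.
Their absolute values depend only on `|i - j|` and on the minimum of `i` and `j`, and they are
piecewise linear along each diagonal (`negRow`, `posRow`). Log-concavity is then a finite number of
quadratic inequalities. For all truncations at once, the absence of interior zeros follows from
quasi-concavity: each integer point is separated by a linear functional from all points where the
sequence has a larger absolute value (`noInteriorZeros_of_separated`).
-/

/-! ### The functor on the diagrams of twist knots -/

namespace Idx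

/-- The basis index of the empty tensor product. -/
def nil : Idx [] := ()

/-- The basis index with first entry `a`. -/
def cons {d : Dir} {w : List Dir} (a : Fin 4) (x : Idx w) : Idx (d :: w) := (a, x)

/-- The first entry of a basis index. -/
def head {d : Dir} {w : List Dir} (x : Idx (d :: w)) : Fin 4 := x.1

/-- The basis index without its first entry. -/
def tail {d : Dir} {w : List Dir} (x : Idx (d :: w)) : Idx w := x.2

theorem cons_head_tail {d : Dir} {w : List Dir} (x : Idx (d :: w)) : cons x.head x.tail = x := rfl

theorem eq_nil (x : Idx []) : x = nil := rfl

theorem sum_nil {M : Type*} [AddCommMonoid M] (f : Idx [] → M) : ∑ x, f x = f nil :=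
  Fintype.sum_unique (ι := Unit) f

theorem sum_cons {M : Type*} [AddCommMonoid M] (d : Dir) (w : List Dir)
    (f : Idx (d :: w) → M) : ∑ x, f x = ∑ a : Fin 4, ∑ y : Idx w, f (cons a y) :=
  Fintype.sum_prod_type (α₁ := Fin 4) (α₂ := Idx w) f

theorem one_cons {K : Type*} [Field K] (d : Dir) (w : List Dir) (a b : Fin 4) (x y : Idx w) :
    (1 : Matrix (Idx (d :: w)) (Idx (d :: w)) K) (cons a x) (cons b y) =
      if a = b then (1 : Matrix (Idx w) (Idx w) K) x y else 0 := by
  by_cases h : a = b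
  · subst h
    by_cases h2 : x = y
    · subst h2; simp
    · have : (cons a x : Idx (d :: w)) ≠ cons a y := fun e => h2 (congrArg Prod.snd e)
      simp [Matrix.one_apply_ne this, Matrix.one_apply_ne h2]
  · have : (cons a x : Idx (d :: w)) ≠ cons b y := fun e => h (congrArg Prod.fst e)
    simp [Matrix.one_apply_ne this, h]

theorem one_nil {K : Type*} [Field K] (o i : Idx []) :
    (1 : Matrix (Idx []) (Idx []) K) o i = 1 := by
  rw [eq_nil o, eq_nil i, Matrix.one_apply_eq]

end Idx

section Functor

open Idx

variable {K : Type*} [Field K] (R : Matrix (Fin 4 × Fin 4) (Fin 4 × Fin 4) K) (h : Fin 4 → K)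

/-- The matrix of a tangle with two ends at the bottom and two ends at the top, with its rows and
columns indexed by pairs. -/
def pairMatrix {K : Type*} {a b c d : Dir} (A : Matrix (Idx [a, b]) (Idx [c, d]) K) :
    Matrix (Fin 4 × Fin 4) (Fin 4 × Fin 4) K :=
  fun o i => A (Idx.cons o.1 (Idx.cons o.2 Idx.nil)) (Idx.cons i.1 (Idx.cons i.2 Idx.nil))

theorem pairMatrix_mul {a b c d e f : Dir}
    (A : Matrix (Idx [a, b]) (Idx [c, d]) K) (B : Matrix (Idx [c, d]) (Idx [e, f]) K) :
    pairMatrix (A * B) = pairMatrix A * pairMatrix B := by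
  ext o i
  simp only [pairMatrix, Matrix.mul_apply, Idx.sum_cons, Idx.sum_nil, Fintype.sum_prod_type]

theorem pairMatrix_cross : pairMatrix (reshetikhinTuraev R h .cross) = R := rfl

theorem pairMatrix_crossInv : pairMatrix (reshetikhinTuraev R h .crossInv) = R⁻¹ := rfl

/-- The matrix of a crossing rotated clockwise by a right angle. -/
def rotateRight (X : Matrix (Fin 4 × Fin 4) (Fin 4 × Fin 4) K) :
    Matrix (Fin 4 × Fin 4) (Fin 4 × Fin 4) K :=
  fun o i => (h o.1)⁻¹ * h i.2 * X (o.2, i.2) (o.1, i.1)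

/-- The matrix of a crossing rotated counterclockwise by a right angle. -/
def rotateLeft (X : Matrix (Fin 4 × Fin 4) (Fin 4 × Fin 4) K) :
    Matrix (Fin 4 × Fin 4) (Fin 4 × Fin 4) K :=
  fun o i => X (i.1, o.1) (i.2, o.2)

theorem pairMatrix_halfTwistUpDown (X : Tangle [up, up] [up, up]) :
    pairMatrix (reshetikhinTuraev R h (Tangle.halfTwistUpDown X)) =
      rotateRight h (pairMatrix (reshetikhinTuraev R h X)) := by
  -- the three layers of the diagram, with boundary words in normal form
  obtain ⟨A, hA⟩ : ∃ A : Matrix (Idx [down, up, up, down]) (Idx [up, down]) K,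
      A = reshetikhinTuraev R h (Tangle.cupDownUp.beside (.strands [up, down])) := ⟨_, rfl⟩
  obtain ⟨B, hB⟩ : ∃ B : Matrix (Idx [down, up, up, down]) (Idx [down, up, up, down]) K,
      B = reshetikhinTuraev R h ((Tangle.strands [down]).beside (X.beside (.strands [down]))) :=
    ⟨_, rfl⟩
  obtain ⟨C, hC⟩ : ∃ C : Matrix (Idx [down, up]) (Idx [down, up, up, down]) K,
      C = reshetikhinTuraev R h ((Tangle.strands [down, up]).beside .capUpDown) := ⟨_, rfl⟩
  have hT : reshetikhinTuraev R h (Tangle.halfTwistUpDown X) = C * (B * A) := by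
    rw [hA, hB, hC]; rfl
  have hA' : ∀ a b c d i j, A (cons a (cons b (cons c (cons d nil)))) (cons i (cons j nil)) =
      (if a = b then (h a)⁻¹ else 0) * if c = i then if d = j then 1 else 0 else 0 := by
    intro a b c d i j
    rw [hA, ← one_nil (K := K) nil nil, ← one_cons down, ← one_cons up]
    rfl
  have hB' : ∀ a b c d i j k l, B (cons a (cons b (cons c (cons d nil))))
      (cons i (cons j (cons k (cons l nil)))) = (if a = i then 1 else 0) *
        (pairMatrix (reshetikhinTuraev R h X) (b, c) (j, k) * if d = l then 1 else 0) := by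
    intro a b c d i j k l
    rw [hB, ← one_nil (K := K) nil nil, ← one_cons down, ← one_cons down]
    rfl
  have hC' : ∀ a b c d i j, C (cons i (cons j nil)) (cons a (cons b (cons c (cons d nil)))) =
      (if i = a then if j = b then 1 else 0 else 0) * if c = d then h c else 0 := by
    intro a b c d i j
    rw [hC, ← one_nil (K := K) nil nil, ← one_cons up, ← one_cons down]
    rfl
  ext ⟨o₁, o₂⟩ ⟨i₁, i₂⟩
  rw [hT]
  simp only [pairMatrix.eq_1 (C * (B * A)), Matrix.mul_apply, sum_cons, sum_nil, hA', hB', hC']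
  simp [rotateRight]
  ring

theorem pairMatrix_halfTwistDownUp (X : Tangle [up, up] [up, up]) :
    pairMatrix (reshetikhinTuraev R h (Tangle.halfTwistDownUp X)) =
      rotateLeft (pairMatrix (reshetikhinTuraev R h X)) := by
  obtain ⟨A, hA⟩ : ∃ A : Matrix (Idx [down, up, up, down]) (Idx [down, up]) K,
      A = reshetikhinTuraev R h ((Tangle.strands [down, up]).beside .cupUpDown) := ⟨_, rfl⟩
  obtain ⟨B, hB⟩ : ∃ B : Matrix (Idx [down, up, up, down]) (Idx [down, up, up, down]) K,
      B = reshetikhinTuraev R h ((Tangle.strands [down]).beside (X.beside (.strands [down]))) :=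
    ⟨_, rfl⟩
  obtain ⟨C, hC⟩ : ∃ C : Matrix (Idx [up, down]) (Idx [down, up, up, down]) K,
      C = reshetikhinTuraev R h (Tangle.capDownUp.beside (.strands [up, down])) := ⟨_, rfl⟩
  have hT : reshetikhinTuraev R h (Tangle.halfTwistDownUp X) = C * (B * A) := by
    rw [hA, hB, hC]; rfl
  have hA' : ∀ a b c d i j, A (cons a (cons b (cons c (cons d nil)))) (cons i (cons j nil)) =
      (if a = i then if b = j then 1 else 0 else 0) * if c = d then 1 else 0 := by
    intro a b c d i j
    rw [hA, ← one_nil (K := K) nil nil, ← one_cons up, ← one_cons down]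
    rfl
  have hB' : ∀ a b c d i j k l, B (cons a (cons b (cons c (cons d nil))))
      (cons i (cons j (cons k (cons l nil)))) = (if a = i then 1 else 0) *
        (pairMatrix (reshetikhinTuraev R h X) (b, c) (j, k) * if d = l then 1 else 0) := by
    intro a b c d i j k l
    rw [hB, ← one_nil (K := K) nil nil, ← one_cons down, ← one_cons down]
    rfl
  have hC' : ∀ a b c d i j, C (cons i (cons j nil)) (cons a (cons b (cons c (cons d nil)))) =
      (if a = b then 1 else 0) * if i = c then if j = d then 1 else 0 else 0 := by
    intro a b c d i j
    rw [hC, ← one_nil (K := K) nil nil, ← one_cons down [] j d, ← one_cons up _ i c]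
    rfl
  ext ⟨o₁, o₂⟩ ⟨i₁, i₂⟩
  rw [hT]
  simp only [pairMatrix.eq_1 (C * (B * A)), Matrix.mul_apply, sum_cons, sum_nil, hA', hB', hC']
  simp [rotateLeft]

/-- The matrix of the tangle that arises when the twist region with matrix `T` is closed up with a
clasp with matrix `C`, as in the standard diagram of a twist knot. -/
def claspClosure (T C : Matrix (Fin 4 × Fin 4) (Fin 4 × Fin 4) K) : Matrix (Fin 4) (Fin 4) K :=
  fun o i => ∑ c, ∑ e, ∑ f, (h c)⁻¹ * T (e, f) (i, c) * C (e, o) (f, c)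

/-- The standard diagram of a twist knot, with an arbitrary tangle `T` as its twist region and two
copies of `X` as its clasp. -/
def twistDiagram (T : Tangle [up, down] [down, up]) (X : Tangle [up, up] [up, up]) :
    Tangle [up] [up] :=
  (((((Tangle.strands [up]).beside .cupDownUp : Tangle [up] [up, down, up]).stack
    (T.beside (.strands [up]))).stack
    ((Tangle.strands [down]).beside X)).stack
    ((Tangle.strands [down]).beside X)).stack
    (Tangle.capDownUp.beside (.strands [up]))

theorem rt_twistDiagram (T : Tangle [up, down] [down, up]) (X : Tangle [up, up] [up, up])
    (o i : Fin 4) :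
    reshetikhinTuraev R h (twistDiagram T X) (cons o nil) (cons i nil) =
      claspClosure h (pairMatrix (reshetikhinTuraev R h T))
        (pairMatrix (reshetikhinTuraev R h X) * pairMatrix (reshetikhinTuraev R h X)) o i := by
  obtain ⟨A, hA⟩ : ∃ A : Matrix (Idx [up, down, up]) (Idx [up]) K,
      A = reshetikhinTuraev R h ((Tangle.strands [up]).beside .cupDownUp) := ⟨_, rfl⟩
  obtain ⟨B, hB⟩ : ∃ B : Matrix (Idx [down, up, up]) (Idx [up, down, up]) K,
      B = reshetikhinTuraev R h (T.beside (.strands [up])) := ⟨_, rfl⟩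
  obtain ⟨C, hC⟩ : ∃ C : Matrix (Idx [down, up, up]) (Idx [down, up, up]) K,
      C = reshetikhinTuraev R h ((Tangle.strands [down]).beside X) := ⟨_, rfl⟩
  obtain ⟨D, hD⟩ : ∃ D : Matrix (Idx [up]) (Idx [down, up, up]) K,
      D = reshetikhinTuraev R h (Tangle.capDownUp.beside (.strands [up])) := ⟨_, rfl⟩
  have hT : reshetikhinTuraev R h (twistDiagram T X) = D * (C * (C * (B * A))) := by
    rw [hA, hB, hC, hD]; rfl
  have hA' : ∀ a b c i, A (cons a (cons b (cons c nil))) (cons i nil) =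
      (if a = i then 1 else 0) * if b = c then (h b)⁻¹ else 0 := by
    intro a b c i
    rw [hA, ← one_nil (K := K) nil nil, ← one_cons up]
    rfl
  have hB' : ∀ a b c i j k, B (cons a (cons b (cons c nil))) (cons i (cons j (cons k nil))) =
      pairMatrix (reshetikhinTuraev R h T) (a, b) (i, j) * if c = k then 1 else 0 := by
    intro a b c i j k
    rw [hB, ← one_nil (K := K) nil nil, ← one_cons up]
    rfl
  have hC' : ∀ a b c i j k, C (cons a (cons b (cons c nil))) (cons i (cons j (cons k nil))) =
      (if a = i then 1 else 0) * pairMatrix (reshetikhinTuraev R h X) (b, c) (j, k) := by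
    intro a b c i j k
    rw [hC, ← one_nil (K := K) nil nil, ← one_cons down]
    rfl
  have hD' : ∀ a b c i, D (cons i nil) (cons a (cons b (cons c nil))) =
      (if a = b then 1 else 0) * if i = c then 1 else 0 := by
    intro a b c i
    rw [hD, ← one_nil (K := K) nil nil, ← one_cons up _ i c]
    rfl
  rw [hT, ← Matrix.mul_assoc, ← Matrix.mul_assoc, Matrix.mul_assoc D]
  have hCC : ∀ a b c i j k, (C * C) (cons a (cons b (cons c nil))) (cons i (cons j (cons k nil))) =
      (if a = i then 1 else 0) * (pairMatrix (reshetikhinTuraev R h X) *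
        pairMatrix (reshetikhinTuraev R h X)) (b, c) (j, k) := by
    intro a b c i j k
    simp only [Matrix.mul_apply, sum_cons, sum_nil, hC', Fintype.sum_prod_type]
    simp
  have hDCC : ∀ a b c i, (D * (C * C)) (cons i nil) (cons a (cons b (cons c nil))) =
      (pairMatrix (reshetikhinTuraev R h X) *
        pairMatrix (reshetikhinTuraev R h X)) (a, i) (b, c) := by
    intro a b c i
    rw [Matrix.mul_apply]
    simp only [sum_cons, sum_nil, hD', hCC]
    simp
  have hBA : ∀ a b c i, (B * A) (cons a (cons b (cons c nil))) (cons i nil) =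
      (h c)⁻¹ * pairMatrix (reshetikhinTuraev R h T) (a, b) (i, c) := by
    intro a b c i
    simp only [Matrix.mul_apply, sum_cons, sum_nil, hA', hB']
    simp [mul_comm]
  rw [Matrix.mul_apply]
  simp only [sum_cons, sum_nil, hDCC, hBA, claspClosure]
  rw [Finset.sum_comm (f := fun c e => ∑ f, (h c)⁻¹ * _ * _)]
  refine Finset.sum_congr rfl fun e _ => ?_
  rw [Finset.sum_comm]
  exact Finset.sum_congr rfl fun c _ => Finset.sum_congr rfl fun f _ => by ring

/-! ### Exact computation with the entries of the Links-Gould matrices -/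

/-- A term `c * s₀ ^ a * s₁ ^ b` or, if `y` is set, `c * s₀ ^ a * s₁ ^ b * Y`. -/
structure LGTerm where
  /-- the coefficient -/
  c : ℤ
  /-- the exponent of `s₀` -/
  a : ℤ
  /-- the exponent of `s₁` -/
  b : ℤ
  /-- whether the factor `Y` is present -/
  y : Bool

/-- Expressions for the elements of the ring
`ℤ[s₀^{±1}, s₁^{±1}, Y] / (Y ^ 2 = (s₀ ^ 2 - 1) * (1 - s₁ ^ 2))`: a list of terms stands for its
sum. Unlike elements of a field, these can be compared by evaluation in the kernel. -/
abbrev LGPoly : Type := List LGTerm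

namespace LGPoly

/-- The order of the integers, in a form that the kernel evaluates quickly. -/
def ltInt : ℤ → ℤ → Bool
  | .ofNat m, .ofNat n => Nat.blt m n
  | .ofNat _, .negSucc _ => false
  | .negSucc _, .ofNat _ => true
  | .negSucc m, .negSucc n => Nat.blt n m

/-- Putting a term in front of an expression, unless it vanishes. -/
def consTerm (t : LGTerm) (p : LGPoly) : LGPoly :=
  match t.c with
  | .ofNat 0 => p
  | _ => t :: p

/-- Adding a term to a sorted expression. -/
noncomputable def insert (t : LGTerm) (p : LGPoly) : LGPoly :=
  List.rec [t] (fun u p ih =>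
    bif ltInt t.a u.a then t :: u :: p
    else bif ltInt u.a t.a then u :: ih
    else bif ltInt t.b u.b then t :: u :: p
    else bif ltInt u.b t.b then u :: ih
    else bif t.y then
      bif u.y then consTerm ⟨Int.add t.c u.c, u.a, u.b, true⟩ p else t :: u :: p
    else
      bif u.y then u :: ih else consTerm ⟨Int.add t.c u.c, u.a, u.b, false⟩ p) p

/-- Adding the product of two terms to a sorted expression; `Y ^ 2` is expanded. -/
noncomputable def insertMul (t u : LGTerm) (p : LGPoly) : LGPoly :=
  bif t.y then
    bif u.y then
      insert ⟨Int.mul t.c u.c, Int.add (Int.add t.a u.a) 2, Int.add t.b u.b, false⟩ <|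
      insert ⟨Int.neg (Int.mul t.c u.c), Int.add (Int.add t.a u.a) 2,
        Int.add (Int.add t.b u.b) 2, false⟩ <|
      insert ⟨Int.neg (Int.mul t.c u.c), Int.add t.a u.a, Int.add t.b u.b, false⟩ <|
      insert ⟨Int.mul t.c u.c, Int.add t.a u.a, Int.add (Int.add t.b u.b) 2, false⟩ p
    else insert ⟨Int.mul t.c u.c, Int.add t.a u.a, Int.add t.b u.b, true⟩ p
  else insert ⟨Int.mul t.c u.c, Int.add t.a u.a, Int.add t.b u.b, u.y⟩ p

/-- Adding the product of two expressions to a sorted expression. -/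
noncomputable def addMul (p q r : LGPoly) : LGPoly :=
  List.rec r (fun t _ ih => List.rec ih (fun u _ ih' => insertMul t u ih') q) p

/-- The product. -/
noncomputable def mul (p q : LGPoly) : LGPoly := addMul p q []

/-- The monomial `c * s₀ ^ a * s₁ ^ b`. -/
def mono (c a b : ℤ) : LGPoly := [⟨c, a, b, false⟩]

/-- The monomial `c * s₀ ^ a * s₁ ^ b * Y`. -/
def monoY (c a b : ℤ) : LGPoly := [⟨c, a, b, true⟩]

/-- A test that implies that two expressions have the same value. -/
noncomputable def equal (p q : LGPoly) : Bool :=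
  (addMul (mono (-1) 0 0) q (addMul (mono 1 0 0) p [])).isEmpty

/-- The composition of four maps. -/
def foldr4 (f : Fin 4 → LGPoly → LGPoly) (p : LGPoly) : LGPoly := f 0 (f 1 (f 2 (f 3 p)))

/-- Conjunction over four indices. -/
def all4 (f : Fin 4 → Bool) : Bool := f 0 && f 1 && f 2 && f 3

/-- Matrices of endomorphisms of `W ⊗ W` with entries in `LGPoly`. -/
abbrev Mat : Type := Fin 4 → Fin 4 → Fin 4 → Fin 4 → LGPoly

/-- The matrix product. -/
noncomputable def matMul (A B : Mat) : Mat := fun o₁ o₂ i₁ i₂ =>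
  foldr4 (fun k => foldr4 fun l => addMul (A o₁ o₂ k l) (B k l i₁ i₂)) []

/-- The linear combination `p A + q B`. -/
noncomputable def matLin (p : LGPoly) (A : Mat) (q : LGPoly) (B : Mat) : Mat := fun o₁ o₂ i₁ i₂ =>
  addMul p (A o₁ o₂ i₁ i₂) (addMul q (B o₁ o₂ i₁ i₂) [])

/-- The identity matrix. -/
noncomputable def matOne : Mat := fun o₁ o₂ i₁ i₂ => if o₁ = i₁ ∧ o₂ = i₂ then mono 1 0 0 else []

/-- Equality of all entries. -/
noncomputable def matEqual (A B : Mat) : Bool :=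
  all4 fun a => all4 fun b => all4 fun c => all4 fun d => equal (A a b c d) (B a b c d)

/-- The images of the basis vectors under the Links-Gould `R`-matrix, as lists of coefficients. -/
noncomputable def rImage : Fin 4 → Fin 4 → List (Fin 4 × Fin 4 × LGPoly) :=
  ![![[(0, 0, mono 1 2 0)],
      [(1, 0, mono 1 1 0)],
      [(2, 0, mono 1 1 0)],
      [(3, 0, mono 1 0 0)]],
    ![[(0, 1, mono 1 1 0), (1, 0, mono 1 2 0 ++ mono (-1) 0 0)],
      [(1, 1, mono (-1) 0 0)],
      [(1, 2, mono 1 2 2 ++ mono (-1) 0 0), (2, 1, mono (-1) 1 1), (3, 0, monoY (-1) 1 1)],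
      [(3, 1, mono 1 0 1)]],
    ![[(0, 2, mono 1 1 0), (2, 0, mono 1 2 0 ++ mono (-1) 0 0)],
      [(1, 2, mono (-1) 1 1), (3, 0, monoY 1 0 0)],
      [(2, 2, mono (-1) 0 0)],
      [(3, 2, mono 1 0 1)]],
    ![[(0, 3, mono 1 0 0), (1, 2, monoY (-1) 1 1), (2, 1, monoY 1 0 0),
        (3, 0, mul (monoY 1 0 0) (monoY 1 0 0))],
      [(1, 3, mono 1 0 1), (3, 1, mono 1 0 2 ++ mono (-1) 0 0)],
      [(2, 3, mono 1 0 1), (3, 2, mono 1 0 2 ++ mono (-1) 0 0)],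
      [(3, 3, mono 1 0 2)]]]

/-- The Links-Gould `R`-matrix. -/
noncomputable def matR : Mat := fun o₁ o₂ i₁ i₂ =>
  (rImage i₁ i₂).flatMap fun x => if x.1 = o₁ ∧ x.2.1 = o₂ then x.2.2 else []

/-- The inverse of the Links-Gould `R`-matrix, expressed through the cubic relation
`(R - t₀) (R + 1) (R - t₁) = 0`. -/
noncomputable def matRInv : Mat :=
  matLin (mono (-1) (-2) (-2)) (matMul matR matR) (mono (-1) 0 0)
    (matLin (mono 1 (-2) (-2) ++ mono (-1) 0 (-2) ++ mono (-1) (-2) 0) matR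
      (mono 1 0 0 ++ mono (-1) 0 (-2) ++ mono (-1) (-2) 0) matOne)

/-- The Links-Gould enhancement. -/
noncomputable def diagH : Fin 4 → LGPoly :=
  ![mono 1 (-2) 0, mono (-1) 0 2, mono (-1) (-2) 0, mono 1 0 2]

/-- The inverse of the Links-Gould enhancement. -/
noncomputable def diagHInv : Fin 4 → LGPoly :=
  ![mono 1 2 0, mono (-1) 0 (-2), mono (-1) 2 0, mono 1 0 (-2)]

/-- The clockwise rotation of a crossing. -/
noncomputable def matRotateRight (X : Mat) : Mat := fun o₁ o₂ i₁ i₂ =>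
  mul (mul (diagHInv o₁) (diagH i₂)) (X o₂ i₂ o₁ i₁)

/-- The counterclockwise rotation of a crossing. -/
noncomputable def matRotateLeft (X : Mat) : Mat := fun o₁ o₂ i₁ i₂ => X i₁ o₁ i₂ o₂

/-- The entries of the closure with a clasp. -/
noncomputable def matClaspClosure (T C : Mat) : Fin 4 → Fin 4 → LGPoly := fun o i =>
  foldr4 (fun c => foldr4 fun e => foldr4 fun f =>
    addMul (mul (diagHInv c) (T e f i c)) (C e o f c)) []

/-- The matrix of a full twist. -/
noncomputable def fullTwist (X : Mat) : Mat := matMul (matRotateRight X) (matRotateLeft X)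

/-- With `M` the full twist and `U` the half twist, the matrix `(M - 1) U`. -/
noncomputable def twistDiff (X : Mat) : Mat :=
  matLin (mono 1 0 0) (matMul (fullTwist X) (matRotateRight X)) (mono (-1) 0 0) (matRotateRight X)

/-- With `M` the full twist and `U` the half twist, the matrix `(M - 1) ^ 2 U`. -/
noncomputable def twistDiff₂ (X : Mat) : Mat :=
  matLin (mono 1 0 0) (matMul (fullTwist X) (twistDiff X)) (mono (-1) 0 0) (twistDiff X)

/-- The test for the relation `M (M - 1) ^ 2 U = r (M - 1) ^ 2 U`, where `M` is the full twist and
`U` the half twist. -/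
noncomputable def twistRelation (X : Mat) (r : LGPoly) : Bool :=
  matEqual (matMul (fullTwist X) (twistDiff₂ X)) (matLin r (twistDiff₂ X) [] matOne)

/-- The test whether the closure of `T` with the clasp `C` is `p` times the identity. -/
noncomputable def closesTo (T C : Mat) (p : LGPoly) : Bool :=
  all4 fun o => all4 fun i => equal (matClaspClosure T C o i) (if o = i then p else [])

/-- The polynomial in `t₀ ^ e` and `t₁ ^ e` with the terms `c * t₀ ^ (e * i) * t₁ ^ (e * j)` for
`(c, i, j)` in the list. -/
noncomputable def ofTerms (e : ℤ) (l : List (ℤ × ℤ × ℤ)) : LGPoly :=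
  l.map fun x => ⟨x.1, 2 * e * x.2.1, 2 * e * x.2.2, false⟩

/-- The increment `(r - 1) a₀ + a₁ + a₂`. -/
noncomputable def increment (r a₀ a₁ a₂ : LGPoly) : LGPoly :=
  mul (r ++ mono (-1) 0 0) a₀ ++ a₁ ++ a₂

/-- The test whether, with `M` the full twist, `U` the half twist and `r` the third eigenvalue of
`M`, the values of `U`, `(M - 1) U` and `(M - 1) ^ 2 U` under the closure with the clasp `C` are
those that make the values of `M ^ k U` equal to
`r ^ k a₀ + a₁ ∑ r ^ j + a₂ ∑ (2 k - 2 j - 1) r ^ j`. -/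
noncomputable def closureValues (X C : Mat) (r a₀ a₁ a₂ : LGPoly) : Bool :=
  closesTo (matRotateRight X) C a₀ && (closesTo (twistDiff X) C (increment r a₀ a₁ a₂) &&
    closesTo (twistDiff₂ X) C (mul (r ++ mono (-1) 0 0) (increment r a₀ a₁ a₂) ++ a₂ ++ a₂))

/-- The terms of `t₀ t₁`. -/
noncomputable def qTerms : List (ℤ × ℤ × ℤ) := [(1, 1, 1)]

/-- The terms of the first factor in the polynomial of `K_{-l}`, diminished by `t₀ t₁ - 1`. -/
noncomputable def negTerms₁ : List (ℤ × ℤ × ℤ) :=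
  [(3, 0, 0), (-1, 1, 0), (-1, 0, 1), (-1, -1, 0), (-1, 0, -1), (1, -1, -1)]

/-- The terms of the second factor in the polynomial of `K_{-l}`. -/
noncomputable def negTerms₂ : List (ℤ × ℤ × ℤ) :=
  [(4, 0, 0), (-2, 1, 0), (-2, 0, 1), (-2, -1, 0), (-2, 0, -1), (1, 1, 1), (1, -1, -1),
    (1, 1, -1), (1, -1, 1)]

/-- The terms of the first factor in the polynomial of `K_n`. -/
noncomputable def posTerms₀ : List (ℤ × ℤ × ℤ) :=
  [(-1, 2, 1), (-1, 1, 2), (1, 2, 0), (1, 0, 2), (2, 1, 1), (-1, 1, 0), (-1, 0, 1), (1, 0, 0)]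

/-- The terms of the second factor in the polynomial of `K_n`. -/
noncomputable def posTerms₁ : List (ℤ × ℤ × ℤ) :=
  [(1, 2, 2), (-3, 2, 1), (-3, 1, 2), (2, 2, 0), (2, 0, 2), (5, 1, 1), (-3, 1, 0), (-3, 0, 1),
    (2, 0, 0)]

/-- The terms of the third factor in the polynomial of `K_n`. -/
noncomputable def posTerms₂ : List (ℤ × ℤ × ℤ) :=
  [(1, 2, 2), (-2, 2, 1), (-2, 1, 2), (1, 2, 0), (1, 0, 2), (4, 1, 1), (-2, 1, 0), (-2, 0, 1),
    (1, 0, 0)]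

/-- The conjunction of all tests for a twist region with the half twist `X` and the eigenvalue
`t₀ ^ e * t₁ ^ e`: with the clasp `C` the values come from the polynomial of `K_{-l}`, with the
clasp `D` from that of `K_n`. A single conjunction lets the kernel share the common part of the
computation. -/
noncomputable def twistTests (X C D : Mat) (e : ℤ) : Bool :=
  twistRelation X (ofTerms e qTerms) &&
    (closureValues X C (ofTerms e qTerms) (mono 1 0 0) (ofTerms e negTerms₁)
        (ofTerms e negTerms₂) &&
      closureValues X D (ofTerms e qTerms) (ofTerms e posTerms₀) (ofTerms e posTerms₁)
        (ofTerms e posTerms₂))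

/-- The matrix `matRInv` is a right inverse of `matR`, by evaluation in the kernel. -/
theorem matR_mul_matRInv : matEqual (matMul matR matRInv) matOne = true := by
  decide +kernel

/-- All identities for positive crossings in the twist region, by evaluation in the kernel. The two
clasps consist of negative and of positive crossings. -/
theorem twistTests_matR :
    twistTests matR (matMul matRInv matRInv) (matMul matR matR) 1 = true := by
  decide +kernel

/-- All identities for negative crossings in the twist region; in comparison with positive ones,
the variables are inverted. -/
theorem twistTests_matRInv :
    twistTests matRInv (matMul matR matR) (matMul matRInv matRInv) (-1) = true := by
  decide +kernel

end LGPoly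

/-! ### The computation is correct over every field -/

/-- The relations between the parameters of the Links-Gould `R`-matrix. -/
structure LGParameters {K : Type*} [Field K] (s₀ s₁ Y : K) : Prop where
  s₀_ne_zero : s₀ ≠ 0
  s₁_ne_zero : s₁ ≠ 0
  sq_Y : Y ^ 2 = (s₀ ^ 2 - 1) * (1 - s₁ ^ 2)

namespace LGTerm

/-- The value of a term. -/
noncomputable def eval {K : Type*} [Field K] (s₀ s₁ Y : K) (t : LGTerm) : K :=
  (t.c : K) * s₀ ^ t.a * s₁ ^ t.b * bif t.y then Y else 1

end LGTerm

namespace LGPoly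

section Eval

variable {K : Type*} [Field K] (s₀ s₁ Y : K)

/-- The value of an expression. -/
noncomputable def eval (p : LGPoly) : K := (p.map (LGTerm.eval s₀ s₁ Y)).sum

theorem ltInt_iff (m n : ℤ) : ltInt m n = true ↔ m < n := by
  cases m <;> cases n <;> simp [ltInt] <;> omega

@[simp] theorem eval_nil : eval s₀ s₁ Y [] = 0 := rfl

@[simp] theorem eval_cons (t : LGTerm) (p : LGPoly) :
    eval s₀ s₁ Y (t :: p) = t.eval s₀ s₁ Y + eval s₀ s₁ Y p := by simp [eval]

@[simp] theorem eval_append (p q : LGPoly) :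
    eval s₀ s₁ Y (p ++ q) = eval s₀ s₁ Y p + eval s₀ s₁ Y q := by simp [eval]

theorem eval_consTerm (t : LGTerm) (p : LGPoly) :
    eval s₀ s₁ Y (consTerm t p) = t.eval s₀ s₁ Y + eval s₀ s₁ Y p := by
  unfold consTerm
  split
  · rename_i h
    have : t.c = 0 := h
    simp [LGTerm.eval, this]
  · simp

theorem eval_insert (t : LGTerm) (p : LGPoly) :
    eval s₀ s₁ Y (insert t p) = t.eval s₀ s₁ Y + eval s₀ s₁ Y p := by
  induction p with
  | nil => simp [insert]
  | cons u p ih =>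
    have hred : insert t (u :: p) =
        bif ltInt t.a u.a then t :: u :: p
        else bif ltInt u.a t.a then u :: insert t p
        else bif ltInt t.b u.b then t :: u :: p
        else bif ltInt u.b t.b then u :: insert t p
        else bif t.y then
          bif u.y then consTerm ⟨Int.add t.c u.c, u.a, u.b, true⟩ p else t :: u :: p
        else
          bif u.y then u :: insert t p
          else consTerm ⟨Int.add t.c u.c, u.a, u.b, false⟩ p := rfl
    rw [hred]
    cases h1 : ltInt t.a u.a
    swap; · simp
    cases h2 : ltInt u.a t.a
    swap; · simp [ih]; ring
    cases h3 : ltInt t.b u.b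
    swap; · simp
    cases h4 : ltInt u.b t.b
    swap; · simp [ih]; ring
    have ha : t.a = u.a := by
      have := (ltInt_iff t.a u.a).not.1 (by simp [h1])
      have := (ltInt_iff u.a t.a).not.1 (by simp [h2])
      omega
    have hb : t.b = u.b := by
      have := (ltInt_iff t.b u.b).not.1 (by simp [h3])
      have := (ltInt_iff u.b t.b).not.1 (by simp [h4])
      omega
    cases h5 : t.y <;> cases h6 : u.y <;>
      simp [eval_consTerm, LGTerm.eval, h5, h6, ha, hb, ih] <;> ring

variable {s₀ s₁ Y}

theorem eval_insertMul (H : LGParameters s₀ s₁ Y) (t u : LGTerm) (p : LGPoly) :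
    eval s₀ s₁ Y (insertMul t u p) =
      t.eval s₀ s₁ Y * u.eval s₀ s₁ Y + eval s₀ s₁ Y p := by
  have hadd : ∀ m n, Int.add m n = m + n := fun _ _ => rfl
  have hmul : ∀ m n, Int.mul m n = m * n := fun _ _ => rfl
  have hneg : ∀ m, Int.neg m = -m := fun _ => rfl
  have h2 : ∀ x : K, x ^ (2 : ℤ) = x ^ 2 := fun x => by norm_cast
  cases h5 : t.y <;> cases h6 : u.y <;>
    simp only [insertMul, h5, h6, eval_insert, LGTerm.eval, hadd, hmul, hneg, cond_true, cond_false,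
      Int.cast_mul, Int.cast_neg, zpow_add₀ H.s₀_ne_zero, zpow_add₀ H.s₁_ne_zero, h2]
  · ring
  · ring
  · ring
  · linear_combination (-(t.c : K) * u.c * s₀ ^ t.a * s₀ ^ u.a * s₁ ^ t.b * s₁ ^ u.b) * H.sq_Y

theorem eval_addMul (H : LGParameters s₀ s₁ Y) (p q r : LGPoly) :
    eval s₀ s₁ Y (addMul p q r) = eval s₀ s₁ Y p * eval s₀ s₁ Y q + eval s₀ s₁ Y r := by
  induction p with
  | nil => simp [addMul]
  | cons t p ih =>
    have key : ∀ q' : LGPoly,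
        eval s₀ s₁ Y (List.rec (addMul p q r) (fun u _ ih' => insertMul t u ih') q' : LGPoly) =
          t.eval s₀ s₁ Y * eval s₀ s₁ Y q' + eval s₀ s₁ Y (addMul p q r) := by
      intro q'
      induction q' with
      | nil => simp
      | cons u q' ih' =>
        have := eval_insertMul H t u
          (List.rec (addMul p q r) (fun u _ ih' => insertMul t u ih') q' : LGPoly)
        rw [ih'] at this
        rw [eval_cons]
        refine this.trans ?_
        ring
    have := key q
    rw [ih] at this
    rw [eval_cons]
    refine this.trans ?_
    ring

theorem eval_mul (H : LGParameters s₀ s₁ Y) (p q : LGPoly) :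
    eval s₀ s₁ Y (mul p q) = eval s₀ s₁ Y p * eval s₀ s₁ Y q := by
  rw [mul, eval_addMul H, eval_nil, add_zero]

@[simp] theorem eval_mono (c a b : ℤ) : eval s₀ s₁ Y (mono c a b) = c * s₀ ^ a * s₁ ^ b := by
  simp [mono, LGTerm.eval]

@[simp] theorem eval_monoY (c a b : ℤ) :
    eval s₀ s₁ Y (monoY c a b) = c * s₀ ^ a * s₁ ^ b * Y := by
  simp [monoY, LGTerm.eval]

theorem eval_eq_of_equal (H : LGParameters s₀ s₁ Y) {p q : LGPoly} (h : equal p q = true) :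
    eval s₀ s₁ Y p = eval s₀ s₁ Y q := by
  rw [equal, List.isEmpty_iff] at h
  have := congrArg (eval s₀ s₁ Y) h
  simp only [eval_addMul H, eval_mono, eval_nil] at this
  simp at this
  linear_combination this

theorem forall_of_all4 {f : Fin 4 → Bool} (h : all4 f = true) (i : Fin 4) : f i = true := by
  simp only [all4, Bool.and_eq_true] at h
  obtain ⟨⟨⟨h0, h1⟩, h2⟩, h3⟩ := h
  fin_cases i <;> assumption

theorem eval_foldr4 {f : Fin 4 → LGPoly → LGPoly} {g : Fin 4 → K}
    (h : ∀ i p, eval s₀ s₁ Y (f i p) = g i + eval s₀ s₁ Y p) (p : LGPoly) :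
    eval s₀ s₁ Y (foldr4 f p) = ∑ i, g i + eval s₀ s₁ Y p := by
  simp only [foldr4, h, Fin.sum_univ_four]
  ring

variable (s₀ s₁ Y) in
/-- The matrix over `K` that a matrix of expressions stands for. -/
noncomputable def toMatrix (A : Mat) : Matrix (Fin 4 × Fin 4) (Fin 4 × Fin 4) K :=
  fun o i => eval s₀ s₁ Y (A o.1 o.2 i.1 i.2)

theorem toMatrix_matMul (H : LGParameters s₀ s₁ Y) (A B : Mat) :
    toMatrix s₀ s₁ Y (matMul A B) = toMatrix s₀ s₁ Y A * toMatrix s₀ s₁ Y B := by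
  ext o i
  rw [Matrix.mul_apply, Fintype.sum_prod_type]
  simp only [toMatrix, matMul]
  refine (eval_foldr4 (g := fun k => ∑ l, eval s₀ s₁ Y (A o.1 o.2 k l) *
    eval s₀ s₁ Y (B k l i.1 i.2)) (fun k p => eval_foldr4 (fun l p => ?_) p) _).trans ?_
  · exact eval_addMul H _ _ p
  · rw [eval_nil, add_zero]

theorem toMatrix_matLin (H : LGParameters s₀ s₁ Y) (p : LGPoly) (A : Mat) (q : LGPoly) (B : Mat) :
    toMatrix s₀ s₁ Y (matLin p A q B) =
      eval s₀ s₁ Y p • toMatrix s₀ s₁ Y A + eval s₀ s₁ Y q • toMatrix s₀ s₁ Y B := by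
  ext o i
  simp [toMatrix, matLin, eval_addMul H]

theorem toMatrix_matOne : toMatrix s₀ s₁ Y matOne = 1 := by
  ext ⟨a, b⟩ ⟨c, d⟩
  by_cases h : a = c ∧ b = d
  · obtain ⟨rfl, rfl⟩ := h
    simp [toMatrix, matOne]
  · have h' : (a, b) ≠ (c, d) := by simpa using h
    simp [toMatrix, matOne, h, Matrix.one_apply_ne h']

theorem toMatrix_eq_of_matEqual (H : LGParameters s₀ s₁ Y) {A B : Mat}
    (h : matEqual A B = true) : toMatrix s₀ s₁ Y A = toMatrix s₀ s₁ Y B := by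
  ext ⟨a, b⟩ ⟨c, d⟩
  exact eval_eq_of_equal H
    (forall_of_all4 (forall_of_all4 (forall_of_all4 (forall_of_all4 h a) b) c) d)

/-- The table `rImage` has the entries of the table `linksGouldImage`. -/
theorem linksGouldImage_eq (H : LGParameters s₀ s₁ Y) (i j : Fin 4) :
    linksGouldImage s₀ s₁ Y i j =
      ((rImage i j).map fun x => eval s₀ s₁ Y x.2.2 • Pi.single (x.1, x.2.1) (1 : K)).sum := by
  have h2 : ∀ x : K, x ^ (2 : ℤ) = x ^ 2 := fun x => by norm_cast
  fin_cases i <;> fin_cases j <;>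
    simp [linksGouldImage, rImage, eval_mul H, h2, sub_eq_add_neg, neg_smul, ← pow_two] <;> abel

theorem toMatrix_matR (H : LGParameters s₀ s₁ Y) :
    toMatrix s₀ s₁ Y matR = linksGouldR s₀ s₁ Y := by
  ext ⟨a, b⟩ ⟨c, d⟩
  rw [linksGouldR, linksGouldImage_eq H]
  simp only [toMatrix, matR]
  generalize rImage c d = l
  induction l with
  | nil => simp
  | cons x l ih =>
    rw [List.flatMap_cons, eval_append, ih, List.map_cons, List.sum_cons, Pi.add_apply]
    congr 1
    by_cases h : x.1 = a ∧ x.2.1 = b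
    · simp [h]
    · have h' : (a, b) ≠ (x.1, x.2.1) := fun e => h (by simp_all)
      simp [h, h']

/-- The inverse in the image of `crossInv` under the functor is a genuine inverse. -/
theorem linksGouldR_inv (H : LGParameters s₀ s₁ Y) :
    (linksGouldR s₀ s₁ Y)⁻¹ = toMatrix s₀ s₁ Y matRInv := by
  refine Matrix.inv_eq_right_inv ?_
  rw [← toMatrix_matR H, ← toMatrix_matMul H, toMatrix_eq_of_matEqual H matR_mul_matRInv,
    toMatrix_matOne]

theorem eval_diagH (i : Fin 4) : eval s₀ s₁ Y (diagH i) = linksGouldH s₀ s₁ i := by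
  fin_cases i <;> simp [diagH, linksGouldH]

theorem eval_diagHInv (i : Fin 4) : eval s₀ s₁ Y (diagHInv i) = (linksGouldH s₀ s₁ i)⁻¹ := by
  fin_cases i <;> simp [diagHInv, linksGouldH, inv_neg]

theorem toMatrix_matRotateRight (H : LGParameters s₀ s₁ Y) (X : Mat) :
    toMatrix s₀ s₁ Y (matRotateRight X) =
      rotateRight (linksGouldH s₀ s₁) (toMatrix s₀ s₁ Y X) := by
  ext o i
  simp [toMatrix, matRotateRight, rotateRight, eval_mul H, eval_diagH, eval_diagHInv]

theorem toMatrix_matRotateLeft (X : Mat) :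
    toMatrix s₀ s₁ Y (matRotateLeft X) = rotateLeft (toMatrix s₀ s₁ Y X) := rfl

theorem eval_matClaspClosure (H : LGParameters s₀ s₁ Y) (T C : Mat) (o i : Fin 4) :
    eval s₀ s₁ Y (matClaspClosure T C o i) =
      claspClosure (linksGouldH s₀ s₁) (toMatrix s₀ s₁ Y T) (toMatrix s₀ s₁ Y C) o i := by
  refine (eval_foldr4 (g := fun c => ∑ e, ∑ f, (linksGouldH s₀ s₁ c)⁻¹ *
    eval s₀ s₁ Y (T e f i c) * eval s₀ s₁ Y (C e o f c))
    (fun c p => eval_foldr4 (fun e p => eval_foldr4 (fun f p => ?_) p) p) _).trans ?_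
  · rw [eval_addMul H, eval_mul H, eval_diagHInv]
  · rw [eval_nil, add_zero]
    rfl

theorem claspClosure_of_closesTo (H : LGParameters s₀ s₁ Y) {T C : Mat} {p : LGPoly}
    (h : closesTo T C p = true) :
    claspClosure (linksGouldH s₀ s₁) (toMatrix s₀ s₁ Y T) (toMatrix s₀ s₁ Y C) =
      eval s₀ s₁ Y p • 1 := by
  ext o i
  rw [← eval_matClaspClosure H, eval_eq_of_equal H (forall_of_all4 (forall_of_all4 h o) i)]
  by_cases hoi : o = i
  · simp [hoi]
  · simp [hoi]

end Eval
end LGPoly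

/-! ### Powers of the full twist -/

section Twist

variable {K : Type*} [Field K]

theorem claspClosure_add (h : Fin 4 → K) (S T C : Matrix (Fin 4 × Fin 4) (Fin 4 × Fin 4) K) :
    claspClosure h (S + T) C = claspClosure h S C + claspClosure h T C := by
  ext o i
  simp [claspClosure, mul_add, add_mul, Finset.sum_add_distrib]

theorem claspClosure_smul (h : Fin 4 → K) (c : K) (T C : Matrix (Fin 4 × Fin 4) (Fin 4 × Fin 4) K) :
    claspClosure h (c • T) C = c • claspClosure h T C := by
  ext o i
  simp only [claspClosure, Matrix.smul_apply, smul_eq_mul, Finset.mul_sum]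
  refine Finset.sum_congr rfl fun _ _ => Finset.sum_congr rfl fun _ _ =>
    Finset.sum_congr rfl fun _ _ => by ring

theorem mul_geom_double_sum (r : K) (k : ℕ) :
    r * ∑ j ∈ Finset.range k, ∑ i ∈ Finset.range j, r ^ i + k =
      ∑ j ∈ Finset.range (k + 1), ∑ i ∈ Finset.range j, r ^ i := by
  induction k with
  | zero => simp
  | succ k ih =>
    have hg : r * ∑ i ∈ Finset.range k, r ^ i + 1 = ∑ i ∈ Finset.range (k + 1), r ^ i := by
      rw [Finset.sum_range_succ', Finset.mul_sum]
      simp [pow_succ']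
    rw [Finset.sum_range_succ _ (k + 1), ← hg]
    rw [Finset.sum_range_succ _ k] at ih ⊢
    push_cast
    linear_combination ih

/-- Powers of an operator `M` with `(M - r) (M - 1) ^ 2 U = 0`, applied to `U`, where
`E = (M - 1) U` and `F = (M - 1) ^ 2 U`. -/
theorem iterate_eq_of_jordan {n : Type*} [Fintype n] [DecidableEq n] {M U E F : Matrix n n K}
    {r : K} (hU : M * U = U + E) (hE : M * E = E + F) (hF : M * F = r • F)
    {T : ℕ → Matrix n n K} (h0 : T 0 = U) (hT : ∀ k, T (k + 1) = M * T k) (k : ℕ) :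
    T k = U + (k : K) • E + (∑ j ∈ Finset.range k, ∑ i ∈ Finset.range j, r ^ i) • F := by
  induction k with
  | zero => simp [h0]
  | succ k ih =>
    rw [hT, ih, ← mul_geom_double_sum, Matrix.mul_add, Matrix.mul_add, Matrix.mul_smul,
      Matrix.mul_smul, hU, hE, hF]
    push_cast
    module

/-- The constants in front of `1`, `k` and the double geometric sum, computed from the shape
`r ^ k a₀ + a₁ ∑ r ^ j + a₂ ∑ (2 k - 2 j - 1) r ^ j`. -/
theorem double_sum_increment (r a₀ a₁ a₂ : K) (k : ℕ) :
    a₀ + k * ((r - 1) * a₀ + a₁ + a₂) + (∑ j ∈ Finset.range k, ∑ i ∈ Finset.range j, r ^ i) *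
      ((r - 1) * ((r - 1) * a₀ + a₁ + a₂) + a₂ + a₂) =
    r ^ k * a₀ + a₁ * ∑ j ∈ Finset.range k, r ^ j +
      a₂ * ∑ j ∈ Finset.range k, (2 * (k : K) - 2 * j - 1) * r ^ j := by
  have hS : ∀ k : ℕ, ∑ j ∈ Finset.range (k + 1), (2 * ((k + 1 : ℕ) : K) - 2 * j - 1) * r ^ j =
      ∑ j ∈ Finset.range k, (2 * (k : K) - 2 * j - 1) * r ^ j +
        2 * ∑ j ∈ Finset.range k, r ^ j + r ^ k := by
    intro k
    rw [Finset.sum_range_succ, Finset.mul_sum, ← Finset.sum_add_distrib]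
    congr 1
    · exact Finset.sum_congr rfl fun j _ => by push_cast; ring
    · push_cast; ring
  induction k with
  | zero => simp
  | succ k ih =>
    have hg : r ^ k = (r - 1) * ∑ j ∈ Finset.range k, r ^ j + 1 := by
      rw [mul_comm, geom_sum_mul]; ring
    rw [hS, Finset.sum_range_succ _ k, Finset.sum_range_succ _ k, pow_succ]
    push_cast
    linear_combination ih - ((r - 1) * a₀ + a₁ + a₂) * hg

end Twist

namespace LGPoly

variable {K : Type*} [Field K] {s₀ s₁ Y : K}

/-- The family of twist knots in terms of three closures: if the tests for `X` and the clasp hold,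
the functor maps each diagram with `2 k + 1` half twists to the multiple of the identity that the
shape of the explicit polynomials prescribes. -/
theorem twist_closure (H : LGParameters s₀ s₁ Y) {x c : Tangle [up, up] [up, up]} {X C : Mat}
    {r a₀ a₁ a₂ : LGPoly}
    (hx : pairMatrix (reshetikhinTuraev (linksGouldR s₀ s₁ Y) (linksGouldH s₀ s₁) x) =
      toMatrix s₀ s₁ Y X)
    (hc : pairMatrix (reshetikhinTuraev (linksGouldR s₀ s₁ Y) (linksGouldH s₀ s₁) c) =
      toMatrix s₀ s₁ Y C)
    (hr : twistRelation X r = true) (hv : closureValues X (matMul C C) r a₀ a₁ a₂ = true) (k : ℕ) :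
    reshetikhinTuraev (linksGouldR s₀ s₁ Y) (linksGouldH s₀ s₁)
        (twistDiagram (Tangle.oddTwist x k) c) =
      (eval s₀ s₁ Y r ^ k * eval s₀ s₁ Y a₀ +
        eval s₀ s₁ Y a₁ * ∑ j ∈ Finset.range k, eval s₀ s₁ Y r ^ j +
        eval s₀ s₁ Y a₂ * ∑ j ∈ Finset.range k, (2 * (k : K) - 2 * j - 1) * eval s₀ s₁ Y r ^ j) •
        1 := by
  have hM : toMatrix s₀ s₁ Y (fullTwist X) = rotateRight (linksGouldH s₀ s₁) (toMatrix s₀ s₁ Y X) *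
      rotateLeft (toMatrix s₀ s₁ Y X) := by
    rw [fullTwist, toMatrix_matMul H, toMatrix_matRotateRight H, toMatrix_matRotateLeft]
  have hE : toMatrix s₀ s₁ Y (fullTwist X) * toMatrix s₀ s₁ Y (matRotateRight X) =
      toMatrix s₀ s₁ Y (matRotateRight X) + toMatrix s₀ s₁ Y (twistDiff X) := by
    rw [twistDiff, toMatrix_matLin H, toMatrix_matMul H]
    simp
  have hF : toMatrix s₀ s₁ Y (fullTwist X) * toMatrix s₀ s₁ Y (twistDiff X) =
      toMatrix s₀ s₁ Y (twistDiff X) + toMatrix s₀ s₁ Y (twistDiff₂ X) := by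
    rw [twistDiff₂, toMatrix_matLin H, toMatrix_matMul H]
    simp
  have hG : toMatrix s₀ s₁ Y (fullTwist X) * toMatrix s₀ s₁ Y (twistDiff₂ X) =
      eval s₀ s₁ Y r • toMatrix s₀ s₁ Y (twistDiff₂ X) := by
    rw [← toMatrix_matMul H, toMatrix_eq_of_matEqual H hr, toMatrix_matLin H]
    simp
  have hT := iterate_eq_of_jordan hE hF hG
    (T := fun k => pairMatrix (reshetikhinTuraev (linksGouldR s₀ s₁ Y) (linksGouldH s₀ s₁)
      (Tangle.oddTwist x k)))
    (by
      rw [toMatrix_matRotateRight H, ← hx]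
      exact pairMatrix_halfTwistUpDown _ _ x)
    (by
      intro k
      rw [hM, ← hx, ← pairMatrix_halfTwistUpDown, ← pairMatrix_halfTwistDownUp, Matrix.mul_assoc,
        ← pairMatrix_mul, ← pairMatrix_mul]
      rfl) k
  simp only [closureValues, Bool.and_eq_true] at hv
  obtain ⟨h0, h1, h2⟩ := hv
  have hmain : claspClosure (linksGouldH s₀ s₁)
      (pairMatrix (reshetikhinTuraev (linksGouldR s₀ s₁ Y) (linksGouldH s₀ s₁)
        (Tangle.oddTwist x k)))
      (toMatrix s₀ s₁ Y C * toMatrix s₀ s₁ Y C) =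
      (eval s₀ s₁ Y r ^ k * eval s₀ s₁ Y a₀ +
        eval s₀ s₁ Y a₁ * ∑ j ∈ Finset.range k, eval s₀ s₁ Y r ^ j +
        eval s₀ s₁ Y a₂ * ∑ j ∈ Finset.range k, (2 * (k : K) - 2 * j - 1) * eval s₀ s₁ Y r ^ j) •
        1 := by
    rw [hT, ← toMatrix_matMul H, claspClosure_add, claspClosure_add, claspClosure_smul,
      claspClosure_smul, claspClosure_of_closesTo H h0, claspClosure_of_closesTo H h1,
      claspClosure_of_closesTo H h2, ← double_sum_increment]
    simp only [increment, eval_append, eval_mul H, eval_mono]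
    rw [smul_smul, smul_smul, ← add_smul, ← add_smul]
    congr 1
    simp
    ring
  ext o i
  have := rt_twistDiagram (linksGouldR s₀ s₁ Y) (linksGouldH s₀ s₁) (Tangle.oddTwist x k) c
    o.head i.head
  rw [hc, hmain] at this
  refine this.trans ?_
  rw [Matrix.smul_apply, Matrix.smul_apply]
  congr 1
  rw [← Idx.cons_head_tail o, ← Idx.cons_head_tail i, Idx.one_cons, Idx.one_nil, Matrix.one_apply]
  rfl

end LGPoly

/-! ### Laurent polynomials and their values at the generic point -/

namespace LaurentTwo

section Eval

variable {K : Type*} [Field K]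

/-- Evaluation of Laurent polynomials at two non-zero elements as a ring homomorphism. -/
noncomputable def evalHom (x₀ x₁ : K) (h₀ : x₀ ≠ 0) (h₁ : x₁ ≠ 0) : LaurentTwo →ₐ[ℤ] K :=
  AddMonoidAlgebra.lift ℤ K (ℤ × ℤ)
    { toFun := fun e => x₀ ^ e.toAdd.1 * x₁ ^ e.toAdd.2
      map_one' := by simp
      map_mul' := fun e f => by
        simp only [toAdd_mul, Prod.fst_add, Prod.snd_add, zpow_add₀ h₀, zpow_add₀ h₁]
        ring }

theorem evalHom_apply (x₀ x₁ : K) (h₀ : x₀ ≠ 0) (h₁ : x₁ ≠ 0) (P : LaurentTwo) :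
    evalHom x₀ x₁ h₀ h₁ P = P.eval x₀ x₁ := by
  rw [evalHom, AddMonoidAlgebra.lift_apply, eval]
  simp [zsmul_eq_mul]

@[simp] theorem evalHom_mon (x₀ x₁ : K) (h₀ : x₀ ≠ 0) (h₁ : x₁ ≠ 0) (i j : ℤ) :
    evalHom x₀ x₁ h₀ h₁ (mon i j) = x₀ ^ i * x₁ ^ j := by
  rw [evalHom_apply, eval, mon, AddMonoidAlgebra.coeff_single, Finsupp.sum_single_index] <;> simp

theorem coeff_invertVars (P : LaurentTwo) (e : ℤ × ℤ) : P.invertVars.coeff e = P.coeff (-e) := by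
  rw [invertVars, AddMonoidAlgebra.coeff_domCongr]
  rfl

theorem invertVars_invertVars (P : LaurentTwo) : P.invertVars.invertVars = P := by
  refine AddMonoidAlgebra.coeff_inj.1 (Finsupp.ext fun e => ?_)
  rw [coeff_invertVars, coeff_invertVars, neg_neg]

theorem eval_invertVars (x₀ x₁ : K) (P : LaurentTwo) :
    P.invertVars.eval x₀ x₁ = P.eval x₀⁻¹ x₁⁻¹ := by
  have : P.invertVars.coeff = P.coeff.equivMapDomain (AddEquiv.neg (ℤ × ℤ)).toEquiv := by
    ext e
    rw [coeff_invertVars]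
    rfl
  rw [eval, eval, this, Finsupp.sum_equivMapDomain]
  refine Finset.sum_congr rfl fun e _ => ?_
  simp

end Eval

theorem tvar_ne_zero (i : Fin 2) : tvar i ≠ 0 := by
  rw [tvar, Ne, FaithfulSMul.algebraMap_eq_zero_iff, FaithfulSMul.algebraMap_eq_zero_iff]
  exact MvPolynomial.X_ne_zero i

/-- A Laurent polynomial is determined by its value at the generic point: after multiplication by a
monomial it becomes a polynomial. -/
theorem eq_zero_of_eval_tvar {P : LaurentTwo} (h : P.eval (tvar 0) (tvar 1) = 0) : P = 0 := by
  obtain ⟨N, hN⟩ : ∃ N : ℕ, ∀ e ∈ P.coeff.support, 0 ≤ e.1 + N ∧ 0 ≤ e.2 + N := by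
    refine ⟨∑ e ∈ P.coeff.support, (e.1.natAbs + e.2.natAbs), fun e he => ?_⟩
    have := Finset.single_le_sum (f := fun e : ℤ × ℤ => e.1.natAbs + e.2.natAbs)
      (fun _ _ => Nat.zero_le _) he
    omega
  let m : ℤ × ℤ → Fin 2 →₀ ℕ := fun e =>
    Finsupp.single 0 (e.1 + N).toNat + Finsupp.single 1 (e.2 + N).toNat
  let q : MvPolynomial (Fin 2) ℚ :=
    ∑ e ∈ P.coeff.support, MvPolynomial.monomial (m e) ((P.coeff e : ℤ) : ℚ)
  have hq : algebraMap RatTwo LGField (algebraMap _ RatTwo q) =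
      P.eval (tvar 0) (tvar 1) * (tvar 0 ^ N * tvar 1 ^ N) := by
    rw [eval, Finsupp.sum, Finset.sum_mul, map_sum, map_sum]
    refine Finset.sum_congr rfl fun e he => ?_
    obtain ⟨h0, h1⟩ := hN e he
    have e0 : (tvar 0) ^ (e.1 + N).toNat = tvar 0 ^ e.1 * tvar 0 ^ N := by
      rw [← zpow_natCast, Int.toNat_of_nonneg h0, zpow_add₀ (tvar_ne_zero 0), zpow_natCast]
    have e1 : (tvar 1) ^ (e.2 + N).toNat = tvar 1 ^ e.2 * tvar 1 ^ N := by
      rw [← zpow_natCast, Int.toNat_of_nonneg h1, zpow_add₀ (tvar_ne_zero 1), zpow_natCast]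
    have hm : MvPolynomial.monomial (m e) ((P.coeff e : ℤ) : ℚ) =
        ((P.coeff e : ℤ) : MvPolynomial (Fin 2) ℚ) * (MvPolynomial.X 0 ^ (e.1 + N).toNat *
          MvPolynomial.X 1 ^ (e.2 + N).toNat) := by
      rw [MvPolynomial.X_pow_eq_monomial, MvPolynomial.X_pow_eq_monomial,
        MvPolynomial.monomial_mul, ← map_intCast (MvPolynomial.C (σ := Fin 2) (R := ℚ)),
          MvPolynomial.C_mul_monomial]
      simp [m]
    rw [hm]
    simp only [map_mul, map_pow, map_intCast]
    change _ * (tvar 0 ^ _ * tvar 1 ^ _) = _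
    rw [e0, e1]
    ring
  rw [h, zero_mul, FaithfulSMul.algebraMap_eq_zero_iff, FaithfulSMul.algebraMap_eq_zero_iff] at hq
  refine AddMonoidAlgebra.coeff_inj.1 (Finsupp.ext fun e => ?_)
  by_contra he
  have he : e ∈ P.coeff.support := Finsupp.mem_support_iff.2 he
  have hc := congrArg (MvPolynomial.coeff (m e)) hq
  rw [MvPolynomial.coeff_sum, Finset.sum_eq_single e, MvPolynomial.coeff_monomial, if_pos rfl,
    MvPolynomial.coeff_zero, Int.cast_eq_zero] at hc
  · exact Finsupp.mem_support_iff.1 he hc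
  · intro f hf hfe
    rw [MvPolynomial.coeff_monomial, if_neg]
    intro hm
    have m0 := DFunLike.congr_fun hm 0
    have m1 := DFunLike.congr_fun hm 1
    simp [m] at m0 m1
    have := hN e he
    have := hN f hf
    exact hfe (Prod.ext (by omega) (by omega))
  · exact fun h => absurd he h

theorem eval_tvar_injective {P Q : LaurentTwo}
    (h : P.eval (tvar 0) (tvar 1) = Q.eval (tvar 0) (tvar 1)) : P = Q := by
  rw [← sub_eq_zero]
  apply eq_zero_of_eval_tvar
  rw [← evalHom_apply _ _ (tvar_ne_zero 0) (tvar_ne_zero 1), map_sub, evalHom_apply, evalHom_apply,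
    h, sub_self]

end LaurentTwo

/-- Uniqueness needs that square roots exist at all; `LGField` is algebraically closed. -/
theorem IsLinksGould.unique {T : Tangle [up] [up]} {P Q : LaurentTwo} (hP : IsLinksGould T P)
    (hQ : IsLinksGould T Q) : P = Q := by
  obtain ⟨s₀, h₀⟩ := IsAlgClosed.exists_pow_nat_eq (tvar 0) (n := 2) (by norm_num)
  obtain ⟨s₁, h₁⟩ := IsAlgClosed.exists_pow_nat_eq (tvar 1) (n := 2) (by norm_num)
  obtain ⟨Y, hY⟩ := IsAlgClosed.exists_pow_nat_eq ((tvar 0 - 1) * (1 - tvar 1)) (n := 2)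
    (by norm_num)
  have h := (hP s₀ s₁ Y h₀ h₁ hY).symm.trans (hQ s₀ s₁ Y h₀ h₁ hY)
  have := congrFun (congrFun h (Idx.cons 0 Idx.nil)) (Idx.cons 0 Idx.nil)
  simp only [Matrix.smul_apply, Matrix.one_apply_eq, smul_eq_mul, mul_one] at this
  exact LaurentTwo.eval_tvar_injective this

theorem IsLinksGould.linksGould_eq {T : Tangle [up] [up]} {P : LaurentTwo}
    (hP : IsLinksGould T P) : linksGould T = P := by
  have h : ∃ P, IsLinksGould T P := ⟨P, hP⟩
  rw [linksGould, dif_pos h]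
  exact h.choose_spec.unique hP

/-! ### The Links-Gould polynomials of the twist knots -/

namespace LGPoly

variable {K : Type*} [Field K] {s₀ s₁ Y : K}

theorem eval_ofTerms {x₀ x₁ : K} {e : ℤ} (h₀ : x₀ = s₀ ^ (2 * e)) (h₁ : x₁ = s₁ ^ (2 * e))
    (l : List (ℤ × ℤ × ℤ)) :
    eval s₀ s₁ Y (ofTerms e l) = (l.map fun x => (x.1 : K) * x₀ ^ x.2.1 * x₁ ^ x.2.2).sum := by
  simp [eval, ofTerms, LGTerm.eval, h₀, h₁, ← zpow_mul, Function.comp_def]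

/-- The value found by the tests agrees with `twistValueNeg`. The term `t₀ t₁ - 1`
missing in `negTerms₁` comes from `(t₀ t₁) ^ l = 1 + (t₀ t₁ - 1) ∑ (t₀ t₁) ^ k`. -/
theorem eval_twistValueNeg {x₀ x₁ : K} {e : ℤ} (hx₀ : x₀ ≠ 0) (hx₁ : x₁ ≠ 0)
    (h₀ : x₀ = s₀ ^ (2 * e)) (h₁ : x₁ = s₁ ^ (2 * e)) (l : ℕ) :
    eval s₀ s₁ Y (ofTerms e qTerms) ^ l * eval s₀ s₁ Y (mono 1 0 0) +
      eval s₀ s₁ Y (ofTerms e negTerms₁) *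
        ∑ j ∈ Finset.range l, eval s₀ s₁ Y (ofTerms e qTerms) ^ j +
      eval s₀ s₁ Y (ofTerms e negTerms₂) *
        ∑ j ∈ Finset.range l, (2 * (l : K) - 2 * j - 1) * eval s₀ s₁ Y (ofTerms e qTerms) ^ j =
    (twistValueNeg l).eval x₀ x₁ := by
  have hg : (x₀ * x₁) ^ l = (x₀ * x₁ - 1) * ∑ j ∈ Finset.range l, (x₀ * x₁) ^ j + 1 := by
    linear_combination -geom_sum_mul (x₀ * x₁) l
  rw [← LaurentTwo.evalHom_apply x₀ x₁ hx₀ hx₁, eval_ofTerms h₀ h₁, eval_ofTerms h₀ h₁,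
    eval_ofTerms h₀ h₁]
  simp only [twistValueNeg, map_add, map_sub, map_mul, map_one, map_sum, map_pow, map_natCast,
    map_ofNat, LaurentTwo.evalHom_mon]
  simp [qTerms, negTerms₁, negTerms₂]
  rw [hg]
  ring

theorem eval_twistValuePosInv {x₀ x₁ : K} {e : ℤ} (hx₀ : x₀ ≠ 0) (hx₁ : x₁ ≠ 0)
    (h₀ : x₀ = s₀ ^ (2 * e)) (h₁ : x₁ = s₁ ^ (2 * e)) (k : ℕ) :
    eval s₀ s₁ Y (ofTerms e qTerms) ^ k * eval s₀ s₁ Y (ofTerms e posTerms₀) +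
      eval s₀ s₁ Y (ofTerms e posTerms₁) *
        ∑ j ∈ Finset.range k, eval s₀ s₁ Y (ofTerms e qTerms) ^ j +
      eval s₀ s₁ Y (ofTerms e posTerms₂) *
        ∑ j ∈ Finset.range k, (2 * (k : K) - 2 * j - 1) * eval s₀ s₁ Y (ofTerms e qTerms) ^ j =
    (twistValuePosInv (k + 1)).eval x₀ x₁ := by
  have hc : ∀ j : ℕ, 2 * ((k : K) + 1) - 2 * j - 3 = 2 * (k : K) - 2 * j - 1 := fun j => by ring
  rw [← LaurentTwo.evalHom_apply x₀ x₁ hx₀ hx₁, eval_ofTerms h₀ h₁, eval_ofTerms h₀ h₁,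
    eval_ofTerms h₀ h₁, eval_ofTerms h₀ h₁]
  simp only [twistValuePosInv, map_add, map_sub, map_mul, map_neg, map_one, map_sum, map_pow,
    map_natCast, map_ofNat, LaurentTwo.evalHom_mon, Nat.add_sub_cancel, Nat.cast_add, Nat.cast_one,
    hc]
  simp [qTerms, posTerms₀, posTerms₁, posTerms₂]
  norm_cast
  ring

end LGPoly

section Values

open LGPoly

theorem lgParameters {s₀ s₁ Y : LGField} (h₀ : s₀ ^ 2 = tvar 0) (h₁ : s₁ ^ 2 = tvar 1)
    (hY : Y ^ 2 = (tvar 0 - 1) * (1 - tvar 1)) : LGParameters s₀ s₁ Y where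
  s₀_ne_zero := by
    rintro rfl
    exact LaurentTwo.tvar_ne_zero 0 (by simp [← h₀])
  s₁_ne_zero := by
    rintro rfl
    exact LaurentTwo.tvar_ne_zero 1 (by simp [← h₁])
  sq_Y := by rw [hY, h₀, h₁]

theorem pairMatrix_cross_eq {s₀ s₁ Y : LGField} (H : LGParameters s₀ s₁ Y) :
    pairMatrix (reshetikhinTuraev (linksGouldR s₀ s₁ Y) (linksGouldH s₀ s₁) .cross) =
      toMatrix s₀ s₁ Y matR := by
  rw [pairMatrix_cross, toMatrix_matR H]

theorem pairMatrix_crossInv_eq {s₀ s₁ Y : LGField} (H : LGParameters s₀ s₁ Y) :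
    pairMatrix (reshetikhinTuraev (linksGouldR s₀ s₁ Y) (linksGouldH s₀ s₁) .crossInv) =
      toMatrix s₀ s₁ Y matRInv := by
  rw [pairMatrix_crossInv, linksGouldR_inv H]

theorem twistTests_and {X C D : Mat} {e : ℤ} (h : twistTests X C D e = true) :
    twistRelation X (ofTerms e qTerms) = true ∧
      closureValues X C (ofTerms e qTerms) (mono 1 0 0) (ofTerms e negTerms₁)
        (ofTerms e negTerms₂) = true ∧
      closureValues X D (ofTerms e qTerms) (ofTerms e posTerms₀) (ofTerms e posTerms₁)
        (ofTerms e posTerms₂) = true := by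
  simpa only [twistTests, Bool.and_eq_true] using h

theorem isLinksGould_cross_crossInv (l : ℕ) :
    IsLinksGould (twistDiagram (Tangle.oddTwist .cross l) .crossInv) (twistValueNeg l) := by
  intro s₀ s₁ Y h₀ h₁ hY
  have H := lgParameters h₀ h₁ hY
  obtain ⟨hr, hv, -⟩ := twistTests_and twistTests_matR
  rw [twist_closure H (pairMatrix_cross_eq H) (pairMatrix_crossInv_eq H) hr hv,
    eval_twistValueNeg (LaurentTwo.tvar_ne_zero 0) (LaurentTwo.tvar_ne_zero 1)
      (by simpa [zpow_ofNat] using h₀.symm) (by simpa [zpow_ofNat] using h₁.symm)]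

theorem isLinksGould_cross_cross (k : ℕ) :
    IsLinksGould (twistDiagram (Tangle.oddTwist .cross k) .cross) (twistValuePosInv (k + 1)) := by
  intro s₀ s₁ Y h₀ h₁ hY
  have H := lgParameters h₀ h₁ hY
  obtain ⟨hr, -, hv⟩ := twistTests_and twistTests_matR
  rw [twist_closure H (pairMatrix_cross_eq H) (pairMatrix_cross_eq H) hr hv,
    eval_twistValuePosInv (LaurentTwo.tvar_ne_zero 0) (LaurentTwo.tvar_ne_zero 1)
      (by simpa [zpow_ofNat] using h₀.symm) (by simpa [zpow_ofNat] using h₁.symm)]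

theorem isLinksGould_crossInv_cross (l : ℕ) :
    IsLinksGould (twistDiagram (Tangle.oddTwist .crossInv l) .cross)
      (twistValueNeg l).invertVars := by
  intro s₀ s₁ Y h₀ h₁ hY
  have H := lgParameters h₀ h₁ hY
  obtain ⟨hr, hv, -⟩ := twistTests_and twistTests_matRInv
  rw [twist_closure H (pairMatrix_crossInv_eq H) (pairMatrix_cross_eq H) hr hv,
    LaurentTwo.eval_invertVars, eval_twistValueNeg (inv_ne_zero (LaurentTwo.tvar_ne_zero 0))
      (inv_ne_zero (LaurentTwo.tvar_ne_zero 1)) (by simp [← h₀, zpow_ofNat])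
      (by simp [← h₁, zpow_ofNat])]

theorem isLinksGould_crossInv_crossInv (k : ℕ) :
    IsLinksGould (twistDiagram (Tangle.oddTwist .crossInv k) .crossInv)
      (twistValuePosInv (k + 1)).invertVars := by
  intro s₀ s₁ Y h₀ h₁ hY
  have H := lgParameters h₀ h₁ hY
  obtain ⟨hr, -, hv⟩ := twistTests_and twistTests_matRInv
  rw [twist_closure H (pairMatrix_crossInv_eq H) (pairMatrix_crossInv_eq H) hr hv,
    LaurentTwo.eval_invertVars, eval_twistValuePosInv (inv_ne_zero (LaurentTwo.tvar_ne_zero 0))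
      (inv_ne_zero (LaurentTwo.tvar_ne_zero 1)) (by simp [← h₀, zpow_ofNat])
      (by simp [← h₁, zpow_ofNat])]

theorem twistKnot_neg (l : ℕ) :
    Tangle.twistKnot (-(l : ℤ)) = twistDiagram (Tangle.oddTwist .cross l) .crossInv := by
  have h : Tangle.twistRegion (-(l : ℤ)) = Tangle.oddTwist .cross l := by
    rw [Tangle.twistRegion, if_neg (by omega)]
    simp
  rw [Tangle.twistKnot, h]
  rfl

theorem twistKnot_pos (k : ℕ) :
    Tangle.twistKnot ((k + 1 : ℕ) : ℤ) = twistDiagram (Tangle.oddTwist .crossInv k) .crossInv := by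
  have h : Tangle.twistRegion ((k + 1 : ℕ) : ℤ) = Tangle.oddTwist .crossInv k := by
    rw [Tangle.twistRegion, if_pos (by omega)]
    simp
  rw [Tangle.twistKnot, h]
  rfl

theorem mirror_oddTwist (X : Tangle [up, up] [up, up]) (k : ℕ) :
    (Tangle.oddTwist X k).mirror = Tangle.oddTwist X.mirror k := by
  induction k with
  | zero => rfl
  | succ k ih =>
    rw [Tangle.oddTwist, Tangle.oddTwist, Tangle.mirror, Tangle.mirror, ih]
    rfl

theorem mirror_twistDiagram (T : Tangle [up, down] [down, up]) (X : Tangle [up, up] [up, up]) :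
    (twistDiagram T X).mirror = twistDiagram T.mirror X.mirror := rfl

/-- The Links-Gould polynomials of the twist knots and their mirror images. -/
theorem isLinksGould_twistKnot_cases {n : ℤ} {T : Tangle [up] [up]}
    (hT : T = Tangle.twistKnot n ∨ T = (Tangle.twistKnot n).mirror) :
    ∃ P, (IsLinksGould T P ∨ IsLinksGould T P.invertVars) ∧
      ((∃ l, P = twistValueNeg l) ∨ ∃ k, P = twistValuePosInv (k + 1)) := by
  rcases le_or_gt n 0 with hn | hn
  · obtain ⟨l, rfl⟩ : ∃ l : ℕ, n = -(l : ℤ) := ⟨n.natAbs, by omega⟩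
    refine ⟨twistValueNeg l, ?_, Or.inl ⟨l, rfl⟩⟩
    rw [twistKnot_neg, mirror_twistDiagram, mirror_oddTwist] at hT
    rcases hT with rfl | rfl
    · exact Or.inl (isLinksGould_cross_crossInv l)
    · exact Or.inr (isLinksGould_crossInv_cross l)
  · obtain ⟨k, rfl⟩ : ∃ k : ℕ, n = ((k + 1 : ℕ) : ℤ) := ⟨(n - 1).natAbs, by omega⟩
    refine ⟨twistValuePosInv (k + 1), ?_, Or.inr ⟨k, rfl⟩⟩
    rw [twistKnot_pos, mirror_twistDiagram, mirror_oddTwist] at hT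
    rcases hT with rfl | rfl
    · exact Or.inr (isLinksGould_crossInv_crossInv k)
    · exact Or.inl (isLinksGould_cross_cross k)

end Values

/-! ### Quasi-concave and log-concave sequences -/

/-- A point in the convex hull of the support cannot be separated from it strictly by a linear
functional. -/
theorem noInteriorZeros_of_separated {a : ℤ → ℤ → ℝ}
    (h : ∀ i j, a i j = 0 → ∃ α β : ℤ, ∀ i' j', a i' j' ≠ 0 →
      α * (i' + j') + β * (i' - j') < α * (i + j) + β * (i - j)) :
    NoInteriorZeros a := by
  ext ⟨i, j⟩
  constructor
  · intro hp
    by_contra hs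
    have h0 : a i j = 0 := by simpa [supp] using hs
    obtain ⟨α, β, hαβ⟩ := h i j h0
    have hlin : IsLinearMap ℝ fun x : ℝ × ℝ => (α : ℝ) * (x.1 + x.2) + β * (x.1 - x.2) :=
      { map_add := fun x y => by simp only [Prod.fst_add, Prod.snd_add]; ring
        map_smul := fun c x => by simp only [Prod.smul_fst, Prod.smul_snd, smul_eq_mul]; ring }
    have hsub := convexHull_min (𝕜 := ℝ)
      (s := (fun q : ℤ × ℤ => ((q.1 : ℝ), (q.2 : ℝ))) '' supp a)
      (t := {x : ℝ × ℝ | (α : ℝ) * (x.1 + x.2) + β * (x.1 - x.2) <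
        (α : ℝ) * (i + j) + β * (i - j)})
      (by
        rintro _ ⟨⟨i', j'⟩, hq, rfl⟩
        have := hαβ i' j' hq
        simp only [Set.mem_ofPred_eq]
        exact_mod_cast this)
      (convex_halfSpace_lt hlin _) hp
    simp at hsub
  · intro hp
    exact subset_convexHull ℝ _ ⟨(i, j), hp, rfl⟩

/-- Discrete quasi-concavity of a two-indexed sequence: every integer point has a linear functional
that is smaller at all points where the sequence has a larger value. The functional is written in
the coordinates `i + j` and `i - j`. -/
def QuasiConcave (b : ℤ → ℤ → ℤ) : Prop :=
  ∀ i j, ∃ α β : ℤ, ∀ i' j', b i j < b i' j' →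
    α * (i' + j') + β * (i' - j') < α * (i + j) + β * (i - j)

/-- The properties of the coefficients of a Laurent polynomial that will be proved for all twist
knots: the signs are those of a chessboard, and the absolute values are quasi-concave and
log-concave. -/
structure LaurentTwo.IsConcaveAlternating (P : LaurentTwo) : Prop where
  nonneg_of_even : ∀ i j, Even (i + j) → 0 ≤ P.coeff (i, j)
  nonpos_of_odd : ∀ i j, ¬Even (i + j) → P.coeff (i, j) ≤ 0
  quasiConcave : QuasiConcave fun i j => |P.coeff (i, j)|
  logConcave : ∀ i j k l, |P.coeff (i + k, j + l)| * |P.coeff (i - k, j - l)| ≤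
    |P.coeff (i, j)| ^ 2

namespace LaurentTwo.IsConcaveAlternating

variable {P : LaurentTwo}

theorem invertVars (h : P.IsConcaveAlternating) : P.invertVars.IsConcaveAlternating where
  nonneg_of_even i j hij := by
    rw [coeff_invertVars]
    exact h.nonneg_of_even (-i) (-j) (by rwa [← neg_add, even_neg])
  nonpos_of_odd i j hij := by
    rw [coeff_invertVars]
    exact h.nonpos_of_odd (-i) (-j) (by rwa [← neg_add, even_neg])
  quasiConcave i j := by
    obtain ⟨α, β, hαβ⟩ := h.quasiConcave (-i) (-j)
    refine ⟨-α, -β, fun i' j' hlt => ?_⟩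
    have := hαβ (-i') (-j') (by simpa only [coeff_invertVars, Prod.neg_mk] using hlt)
    linarith
  logConcave i j k l := by
    have := h.logConcave (-i) (-j) (-k) (-l)
    simp only [coeff_invertVars, Prod.neg_mk]
    convert this using 6 <;> ring

theorem alternates (h : P.IsConcaveAlternating) : Alternates 1 P.coeffSeq := by
  intro i j
  have he : ((1 : ℕ) : ℤ) + i + j + 1 = (i + j) + 2 := by push_cast; ring
  rw [he, coeffSeq]
  by_cases hij : Even (i + j)
  · have := h.nonneg_of_even i j hij
    rw [(hij.add even_two).neg_one_zpow, one_mul, abs_of_nonneg (by exact_mod_cast this)]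
  · have := h.nonpos_of_odd i j hij
    rw [((Int.not_even_iff_odd.1 hij).add_even even_two).neg_one_zpow,
      abs_of_nonpos (by exact_mod_cast this)]
    ring

theorem abs_coeffSeq (i j : ℤ) : |P.coeffSeq i j| = ((|P.coeff (i, j)| : ℤ) : ℝ) := by
  simp [coeffSeq]

/-- Truncations from below have no interior zeros, whatever the signs: a point that does not
belong to the truncation has a smaller absolute value than any point that does. -/
theorem noInteriorZeros_truncation (h : P.IsConcaveAlternating) {a : ℤ → ℤ → ℝ}
    (ha : ∀ i j, |a i j| = |P.coeffSeq i j|) (c : ℝ) :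
    NoInteriorZeros fun i j => if c ≤ |a i j| then a i j else 0 := by
  apply noInteriorZeros_of_separated
  intro i j hij
  obtain ⟨α, β, hαβ⟩ := h.quasiConcave i j
  refine ⟨α, β, fun i' j' hij' => hαβ i' j' ?_⟩
  have h1 : c ≤ |a i' j'| := by
    by_contra hc
    simp [hc] at hij'
  have h2 : 0 < |a i' j'| := by
    rw [abs_pos]
    intro hc
    simp [hc] at hij'
  have h3 : |a i j| < |a i' j'| := by
    by_cases hc : c ≤ |a i j|
    · rw [if_pos hc] at hij
      rwa [hij, abs_zero]
    · exact (not_le.1 hc).trans_le h1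
  rw [ha, ha, abs_coeffSeq, abs_coeffSeq] at h3
  exact_mod_cast h3

theorem noInteriorZeros (h : P.IsConcaveAlternating) {a : ℤ → ℤ → ℝ}
    (ha : ∀ i j, |a i j| = |P.coeffSeq i j|) : NoInteriorZeros a := by
  have := h.noInteriorZeros_truncation ha 0
  simpa using this

theorem twoDLogConcave (h : P.IsConcaveAlternating) : TwoDLogConcave P.absSeq := by
  intro i j k l
  have := h.logConcave i j k l
  simp only [absSeq, abs_coeffSeq]
  exact_mod_cast this

end LaurentTwo.IsConcaveAlternating

/-! ### Sequences in a strip -/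

/-- The sequence on the strip `|i - j| ≤ 2`, symmetric in `i` and `j`, that has the value
`g d (min i j)` where `|i - j| = d`. -/
def stripSeq (g : Fin 3 → ℤ → ℤ) (i j : ℤ) : ℤ :=
  if i = j then g 0 j
  else if i = j + 1 then g 1 j
  else if i = j + 2 then g 2 j
  else if j = i + 1 then g 1 i
  else if j = i + 2 then g 2 i
  else 0

theorem stripSeq_comm (g : Fin 3 → ℤ → ℤ) (i j : ℤ) : stripSeq g i j = stripSeq g j i := by
  unfold stripSeq
  split_ifs <;> first | rfl | omega | (congr 1)

/-- By symmetry, it suffices to separate the points on one side of the main diagonal. -/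
theorem quasiConcave_stripSeq {g : Fin 3 → ℤ → ℤ}
    (h : ∀ i j, j ≤ i → ∃ α β : ℤ, ∀ i' j', stripSeq g i j < stripSeq g i' j' →
      α * (i' + j') + β * (i' - j') < α * (i + j) + β * (i - j)) :
    QuasiConcave (stripSeq g) := by
  intro i j
  rcases le_total j i with hij | hij
  · exact h i j hij
  · obtain ⟨α, β, hαβ⟩ := h j i hij
    refine ⟨α, -β, fun i' j' hlt => ?_⟩
    have := hαβ j' i' (by rwa [stripSeq_comm g j i, stripSeq_comm g j' i'])
    linarith

theorem stripSeq_zero (g : Fin 3 → ℤ → ℤ) {i j m : ℤ} (hi : i = m) (hj : j = m) :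
    stripSeq g i j = g 0 m := by
  subst hi hj; simp [stripSeq]

theorem stripSeq_one (g : Fin 3 → ℤ → ℤ) {i j m : ℤ} (hi : i = m + 1) (hj : j = m) :
    stripSeq g i j = g 1 m := by
  subst hi hj; simp [stripSeq]

theorem stripSeq_two (g : Fin 3 → ℤ → ℤ) {i j m : ℤ} (hi : i = m + 2) (hj : j = m) :
    stripSeq g i j = g 2 m := by
  subst hi hj; simp [stripSeq]

theorem stripSeq_one' (g : Fin 3 → ℤ → ℤ) {i j m : ℤ} (hi : i = m) (hj : j = m + 1) :
    stripSeq g i j = g 1 m := by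
  rw [stripSeq_comm, stripSeq_one g hj hi]

theorem stripSeq_two' (g : Fin 3 → ℤ → ℤ) {i j m : ℤ} (hi : i = m) (hj : j = m + 2) :
    stripSeq g i j = g 2 m := by
  rw [stripSeq_comm, stripSeq_two g hj hi]

theorem stripSeq_eq_zero (g : Fin 3 → ℤ → ℤ) {i j : ℤ} (h : 2 < |i - j|) :
    stripSeq g i j = 0 := by
  unfold stripSeq
  split_ifs <;> first | rfl | (exfalso; grind)

/-- Log-concavity of a sequence in a strip, reduced to one-variable inequalities: one for each
difference of the coordinates at the centre and at the two outer points, up to symmetry. -/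
theorem logConcave_stripSeq {g : Fin 3 → ℤ → ℤ}
    (h00 : ∀ m k, g 0 (m + k) * g 0 (m - k) ≤ g 0 m ^ 2)
    (h01 : ∀ m k, g 1 (m + k) * g 1 (m - k - 1) ≤ g 0 m ^ 2)
    (h02 : ∀ m k, g 2 (m + k) * g 2 (m - k - 2) ≤ g 0 m ^ 2)
    (h10 : ∀ m k, g 1 (m + k) * g 1 (m - k) ≤ g 1 m ^ 2)
    (h11 : ∀ m k, g 2 (m + k) * g 0 (m - k) ≤ g 1 m ^ 2)
    (h20 : ∀ m k, g 2 (m + k) * g 2 (m - k) ≤ g 2 m ^ 2) (i j k l : ℤ) :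
    stripSeq g (i + k) (j + l) * stripSeq g (i - k) (j - l) ≤ stripSeq g i j ^ 2 := by
  by_cases h1 : 2 < |i + k - (j + l)|
  · rw [stripSeq_eq_zero g h1, zero_mul]; positivity
  by_cases h2 : 2 < |i - k - (j - l)|
  · rw [stripSeq_eq_zero g h2, mul_zero]; positivity
  rw [not_lt, abs_le] at h1 h2
  have key : ∀ {a b c : Fin 3} {x y z : ℤ}, stripSeq g (i + k) (j + l) = g a x →
      stripSeq g (i - k) (j - l) = g b y → stripSeq g i j = g c z → g a x * g b y ≤ g c z ^ 2 →
      stripSeq g (i + k) (j + l) * stripSeq g (i - k) (j - l) ≤ stripSeq g i j ^ 2 := by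
    intro a b c x y z ha hb hc h
    rwa [ha, hb, hc]
  -- the difference of the coordinates at the centre, then the change along the direction
  have hd : i - j = -2 ∨ i - j = -1 ∨ i - j = 0 ∨ i - j = 1 ∨ i - j = 2 := by omega
  rcases hd with hd | hd | hd | hd | hd
  · have hδ : k - l = 0 := by omega
    exact key (stripSeq_two' g (m := i + k) (by omega) (by omega))
        (stripSeq_two' g (m := i - k) (by omega) (by omega))
        (stripSeq_two' g (m := i) (by omega) (by omega)) (h20 i k)
  · have hδ : k - l = -1 ∨ k - l = 0 ∨ k - l = 1 := by omega
    rcases hδ with hδ | hδ | hδ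
    · exact key (stripSeq_two' g (m := i + k) (by omega) (by omega))
        (stripSeq_zero g (m := i - k) (by omega) (by omega))
        (stripSeq_one' g (m := i) (by omega) (by omega)) (h11 i k)
    · exact key (stripSeq_one' g (m := i + k) (by omega) (by omega))
        (stripSeq_one' g (m := i - k) (by omega) (by omega))
        (stripSeq_one' g (m := i) (by omega) (by omega)) (h10 i k)
    · exact key (stripSeq_zero g (m := i + k) (by omega) (by omega))
        (stripSeq_two' g (m := i - k) (by omega) (by omega))
        (stripSeq_one' g (m := i) (by omega) (by omega)) (by
        have := h11 i (-k)
        rwa [sub_neg_eq_add, ← sub_eq_add_neg, mul_comm] at this)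
  · have hδ : k - l = -2 ∨ k - l = -1 ∨ k - l = 0 ∨ k - l = 1 ∨ k - l = 2 := by omega
    rcases hδ with hδ | hδ | hδ | hδ | hδ
    · exact key (stripSeq_two' g (m := i + k) (by omega) (by omega))
        (stripSeq_two g (m := i - k - 2) (by omega) (by omega))
        (stripSeq_zero g (m := i) (by omega) (by omega)) (h02 i k)
    · exact key (stripSeq_one' g (m := i + k) (by omega) (by omega))
        (stripSeq_one g (m := i - k - 1) (by omega) (by omega))
        (stripSeq_zero g (m := i) (by omega) (by omega)) (h01 i k)
    · exact key (stripSeq_zero g (m := j + l) (by omega) (by omega))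
        (stripSeq_zero g (m := j - l) (by omega) (by omega))
        (stripSeq_zero g (m := j) (by omega) (by omega)) (h00 j l)
    · exact key (stripSeq_one g (m := j + l) (by omega) (by omega))
        (stripSeq_one' g (m := j - l - 1) (by omega) (by omega))
        (stripSeq_zero g (m := j) (by omega) (by omega)) (h01 j l)
    · exact key (stripSeq_two g (m := j + l) (by omega) (by omega))
        (stripSeq_two' g (m := j - l - 2) (by omega) (by omega))
        (stripSeq_zero g (m := j) (by omega) (by omega)) (h02 j l)
  · have hδ : k - l = -1 ∨ k - l = 0 ∨ k - l = 1 := by omega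
    rcases hδ with hδ | hδ | hδ
    · exact key (stripSeq_zero g (m := j + l) (by omega) (by omega))
        (stripSeq_two g (m := j - l) (by omega) (by omega))
        (stripSeq_one g (m := j) (by omega) (by omega)) (by
        have := h11 j (-l)
        rwa [sub_neg_eq_add, ← sub_eq_add_neg, mul_comm] at this)
    · exact key (stripSeq_one g (m := j + l) (by omega) (by omega))
        (stripSeq_one g (m := j - l) (by omega) (by omega))
        (stripSeq_one g (m := j) (by omega) (by omega)) (h10 j l)
    · exact key (stripSeq_two g (m := j + l) (by omega) (by omega))
        (stripSeq_zero g (m := j - l) (by omega) (by omega))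
        (stripSeq_one g (m := j) (by omega) (by omega)) (h11 j l)
  · have hδ : k - l = 0 := by omega
    exact key (stripSeq_two g (m := j + l) (by omega) (by omega))
        (stripSeq_two g (m := j - l) (by omega) (by omega))
        (stripSeq_two g (m := j) (by omega) (by omega)) (h20 j l)

/-- On the points of the strip where `stripSeq g` has a value above `v`, the functional with the
coordinates `α`, `β` is smaller than `w`; written out on the five diagonals. -/
def LiesBelow (g : Fin 3 → ℤ → ℤ) (v w α β : ℤ) : Prop :=
  (∀ m, v < g 0 m → α * (2 * m) < w) ∧
  (∀ m, v < g 1 m → α * (2 * m + 1) + β < w ∧ α * (2 * m + 1) - β < w) ∧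
  (∀ m, v < g 2 m → α * (2 * m + 2) + 2 * β < w ∧ α * (2 * m + 2) - 2 * β < w)

theorem LiesBelow.lt {g : Fin 3 → ℤ → ℤ} {v w α β : ℤ} (h : LiesBelow g v w α β) (hv : 0 ≤ v)
    {i j : ℤ} (hij : v < stripSeq g i j) : α * (i + j) + β * (i - j) < w := by
  obtain ⟨h0, h1, h2⟩ := h
  unfold stripSeq at hij
  split_ifs at hij with e0 e1 e2 e3 e4
  · subst e0; linarith [h0 _ hij]
  · subst e1; linarith [(h1 _ hij).1]
  · subst e2; linarith [(h2 _ hij).1]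
  · subst e3; linarith [(h1 _ hij).2]
  · subst e4; linarith [(h2 _ hij).2]
  · omega

theorem stripSeq_nonneg {g : Fin 3 → ℤ → ℤ} (hg : ∀ d m, 0 ≤ g d m) (i j : ℤ) :
    0 ≤ stripSeq g i j := by
  unfold stripSeq
  split_ifs <;> first | exact hg _ _ | exact le_rfl

theorem quasiConcave_stripSeq_of_liesBelow {g : Fin 3 → ℤ → ℤ} (hg : ∀ d m, 0 ≤ g d m)
    (h0 : ∀ m, ∃ α β : ℤ, LiesBelow g (g 0 m) (α * (2 * m)) α β)
    (h1 : ∀ m, ∃ α β : ℤ, LiesBelow g (g 1 m) (α * (2 * m + 1) + β) α β)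
    (h2 : ∀ m, ∃ α β : ℤ, LiesBelow g (g 2 m) (α * (2 * m + 2) + 2 * β) α β) :
    QuasiConcave (stripSeq g) := by
  refine quasiConcave_stripSeq fun i j hij => ?_
  have hcase : i = j ∨ i = j + 1 ∨ i = j + 2 ∨ j + 2 < i := by omega
  rcases hcase with hi | hi | hi | hi
  · rw [stripSeq_zero g hi rfl]
    obtain ⟨α, β, h⟩ := h0 j
    exact ⟨α, β, fun i' j' hlt => (h.lt (hg 0 j) hlt).trans_eq (by rw [hi]; ring)⟩
  · rw [stripSeq_one g hi rfl]
    obtain ⟨α, β, h⟩ := h1 j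
    exact ⟨α, β, fun i' j' hlt => (h.lt (hg 1 j) hlt).trans_eq (by rw [hi]; ring)⟩
  · rw [stripSeq_two g hi rfl]
    obtain ⟨α, β, h⟩ := h2 j
    exact ⟨α, β, fun i' j' hlt => (h.lt (hg 2 j) hlt).trans_eq (by rw [hi]; ring)⟩
  · refine ⟨0, 1, fun i' j' hlt => ?_⟩
    have : ¬2 < |i' - j'| := fun h => by
      rw [stripSeq_eq_zero g h] at hlt
      exact (stripSeq_nonneg hg i j).not_gt hlt
    rw [not_lt, abs_le] at this
    linarith

/-! ### Two families of sequences that are piecewise linear along diagonals -/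

/-- The absolute values of the coefficients for `K_{-l}`, `l ≥ 1`, along the diagonals
`|i - j| = 0, 1, 2`, as functions of `min i j`. -/
def negRow (l : ℤ) : Fin 3 → ℤ → ℤ :=
  ![fun m => if m = -1 then 2 * l else if m = 0 then 10 * l - 3
      else if 1 ≤ m ∧ m ≤ l - 1 then 12 * (l - m) - 2 else if m = l then 2 else 0,
    fun m => if m = -1 then 4 * l - 1 else if 0 ≤ m ∧ m ≤ l - 2 then 8 * (l - m) - 6
      else if m = l - 1 then 3 else 0,
    fun m => if -1 ≤ m ∧ m ≤ l - 2 then 2 * (l - m) - 3 else 0]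

/-- The absolute values of the coefficients for `K_n`, `n ≥ 1`, in the inverted variables, along
the diagonals `|i - j| = 0, 1, 2`, as functions of `min i j`. -/
def posRow (n : ℤ) : Fin 3 → ℤ → ℤ :=
  ![fun m => if m = 0 then 2 * n - 1 else if m = n then (if n = 1 then 2 else 4)
      else if m = 1 then 10 * n - 10 else if 2 ≤ m ∧ m ≤ n - 1 then 12 * (n - m) + 2 else 0,
    fun m => if m = 0 then 4 * n - 3 else if m = n then 1
      else if 1 ≤ m ∧ m ≤ n - 1 then 8 * (n - m) - 2 else 0,
    fun m => if 0 ≤ m ∧ m ≤ n - 1 then 2 * (n - m) - 1 else 0]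

theorem negRow_zero (l m : ℤ) : negRow l 0 m = if m = -1 then 2 * l else if m = 0 then 10 * l - 3
      else if 1 ≤ m ∧ m ≤ l - 1 then 12 * (l - m) - 2 else if m = l then 2 else 0 := rfl

theorem negRow_one (l m : ℤ) : negRow l 1 m = if m = -1 then 4 * l - 1
      else if 0 ≤ m ∧ m ≤ l - 2 then 8 * (l - m) - 6 else if m = l - 1 then 3 else 0 := rfl

theorem negRow_two (l m : ℤ) :
    negRow l 2 m = if -1 ≤ m ∧ m ≤ l - 2 then 2 * (l - m) - 3 else 0 := rfl

theorem posRow_zero (n m : ℤ) : posRow n 0 m = if m = 0 then 2 * n - 1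
      else if m = n then (if n = 1 then 2 else 4) else if m = 1 then 10 * n - 10
      else if 2 ≤ m ∧ m ≤ n - 1 then 12 * (n - m) + 2 else 0 := rfl

theorem posRow_one (n m : ℤ) : posRow n 1 m = if m = 0 then 4 * n - 3 else if m = n then 1
      else if 1 ≤ m ∧ m ≤ n - 1 then 8 * (n - m) - 2 else 0 := rfl

theorem posRow_two (n m : ℤ) :
    posRow n 2 m = if 0 ≤ m ∧ m ≤ n - 1 then 2 * (n - m) - 1 else 0 := rfl

theorem negRow_nonneg {l : ℤ} (hl : 1 ≤ l) (d : Fin 3) (m : ℤ) : 0 ≤ negRow l d m := by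
  fin_cases d
  · change 0 ≤ negRow l 0 m
    rw [negRow_zero]; split_ifs <;> omega
  · change 0 ≤ negRow l 1 m
    rw [negRow_one]; split_ifs <;> omega
  · change 0 ≤ negRow l 2 m
    rw [negRow_two]; split_ifs <;> omega

theorem posRow_nonneg {n : ℤ} (hn : 1 ≤ n) (d : Fin 3) (m : ℤ) : 0 ≤ posRow n d m := by
  fin_cases d
  · change 0 ≤ posRow n 0 m
    rw [posRow_zero]; split_ifs <;> omega
  · change 0 ≤ posRow n 1 m
    rw [posRow_one]; split_ifs <;> omega
  · change 0 ≤ posRow n 2 m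
    rw [posRow_two]; split_ifs <;> omega

/-- The values increase for a short initial part of each diagonal and then decrease. Accordingly the
functional points towards smaller or towards larger `i + j`; its component in the direction of
`i - j` takes account of the speed of the decrease along the diagonals. -/
theorem quasiConcave_negRow {l : ℤ} (hl : 1 ≤ l) : QuasiConcave (stripSeq (negRow l)) := by
  refine quasiConcave_stripSeq_of_liesBelow (negRow_nonneg hl) (fun m => ?_) (fun m => ?_)
    (fun m => ?_) <;> simp only [LiesBelow, negRow_zero, negRow_one, negRow_two]
  · rcases le_or_gt m 0 with hm | hm
    · refine ⟨-1, 0, ?_, ?_, ?_⟩ <;> intro m' h <;> split_ifs at h <;> omega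
    · refine ⟨1, 0, ?_, ?_, ?_⟩ <;> intro m' h <;> split_ifs at h <;> omega
  · rcases lt_or_ge m 0 with hm | hm
    · refine ⟨-1, 0, ?_, ?_, ?_⟩ <;> intro m' h <;> split_ifs at h <;> omega
    rcases lt_or_ge m l with hm' | hm'
    · refine ⟨1, 2 * (l - m) - 1, ?_, ?_, ?_⟩ <;> intro m' h <;> split_ifs at h <;> omega
    · refine ⟨1, 1, ?_, ?_, ?_⟩ <;> intro m' h <;> split_ifs at h <;> omega
  · rcases lt_or_ge m (-1) with hm | hm
    · refine ⟨-1, 1, ?_, ?_, ?_⟩ <;> intro m' h <;> split_ifs at h <;> omega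
    rcases lt_or_ge m (l - 1) with hm' | hm'
    · refine ⟨1, 2 * l + 1, ?_, ?_, ?_⟩ <;> intro m' h <;> split_ifs at h <;> omega
    · refine ⟨1, 1, ?_, ?_, ?_⟩ <;> intro m' h <;> split_ifs at h <;> omega

theorem quasiConcave_posRow {n : ℤ} (hn : 1 ≤ n) : QuasiConcave (stripSeq (posRow n)) := by
  refine quasiConcave_stripSeq_of_liesBelow (posRow_nonneg hn) (fun m => ?_) (fun m => ?_)
    (fun m => ?_) <;> simp only [LiesBelow, posRow_zero, posRow_one, posRow_two]
  · by_cases hm : m ≤ 1 ∧ m ≠ n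
    · refine ⟨-1, 0, ?_, ?_, ?_⟩ <;> intro m' h <;> split_ifs at h <;> omega
    · refine ⟨1, 0, ?_, ?_, ?_⟩ <;> intro m' h <;> split_ifs at h <;> omega
  · rcases le_or_gt m 0 with hm | hm
    · refine ⟨-1, 0, ?_, ?_, ?_⟩ <;> intro m' h <;> split_ifs at h <;> omega
    rcases lt_or_ge m n with hm' | hm'
    · refine ⟨1, 2 * (n - m) - 1, ?_, ?_, ?_⟩ <;> intro m' h <;> split_ifs at h <;> omega
    · refine ⟨1, 0, ?_, ?_, ?_⟩ <;> intro m' h <;> split_ifs at h <;> omega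
  · rcases lt_or_ge m 0 with hm | hm
    · refine ⟨-1, 1, ?_, ?_, ?_⟩ <;> intro m' h <;> split_ifs at h <;> omega
    rcases lt_or_ge m n with hm' | hm'
    · refine ⟨1, 4 * n + 4, ?_, ?_, ?_⟩ <;> intro m' h <;> split_ifs at h <;> omega
    · refine ⟨1, 1, ?_, ?_, ?_⟩ <;> intro m' h <;> split_ifs at h <;> omega

set_option maxHeartbeats 1000000 in
theorem negRow_zero_mul_zero_le {l : ℤ} (hl : 1 ≤ l) (m k : ℤ) :
    negRow l 0 (m + k) * negRow l 0 (m - k) ≤ negRow l 0 m ^ 2 := by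
  simp only [negRow_zero]
  split_ifs <;>
    first | omega | (simp only [zero_mul, mul_zero]; positivity) | nlinarith [sq_nonneg k]

set_option maxHeartbeats 1000000 in
theorem negRow_one_mul_one_le_zero {l : ℤ} (hl : 1 ≤ l) (m k : ℤ) :
    negRow l 1 (m + k) * negRow l 1 (m - k - 1) ≤ negRow l 0 m ^ 2 := by
  simp only [negRow_zero, negRow_one]
  split_ifs <;>
    first | omega | (simp only [zero_mul, mul_zero]; positivity) | nlinarith [sq_nonneg k]

set_option maxHeartbeats 1000000 in
theorem negRow_two_mul_two_le_zero {l : ℤ} (hl : 1 ≤ l) (m k : ℤ) :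
    negRow l 2 (m + k) * negRow l 2 (m - k - 2) ≤ negRow l 0 m ^ 2 := by
  simp only [negRow_zero, negRow_two]
  split_ifs <;>
    first | omega | (simp only [zero_mul, mul_zero]; positivity) | nlinarith [sq_nonneg k]

set_option maxHeartbeats 1000000 in
theorem negRow_one_mul_one_le {l : ℤ} (hl : 1 ≤ l) (m k : ℤ) :
    negRow l 1 (m + k) * negRow l 1 (m - k) ≤ negRow l 1 m ^ 2 := by
  simp only [negRow_one]
  split_ifs <;>
    first | omega | (simp only [zero_mul, mul_zero]; positivity) | nlinarith [sq_nonneg k]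

set_option maxHeartbeats 1000000 in
theorem negRow_two_mul_zero_le_one {l : ℤ} (hl : 1 ≤ l) (m k : ℤ) :
    negRow l 2 (m + k) * negRow l 0 (m - k) ≤ negRow l 1 m ^ 2 := by
  simp only [negRow_zero, negRow_one, negRow_two]
  split_ifs <;>
    first | omega | (simp only [zero_mul, mul_zero]; positivity) | nlinarith [sq_nonneg k]

set_option maxHeartbeats 1000000 in
theorem negRow_two_mul_two_le {l : ℤ} (m k : ℤ) :
    negRow l 2 (m + k) * negRow l 2 (m - k) ≤ negRow l 2 m ^ 2 := by
  simp only [negRow_two]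
  split_ifs <;>
    first | omega | (simp only [zero_mul, mul_zero]; positivity) | nlinarith [sq_nonneg k]

theorem logConcave_negRow {l : ℤ} (hl : 1 ≤ l) (i j k m : ℤ) :
    stripSeq (negRow l) (i + k) (j + m) * stripSeq (negRow l) (i - k) (j - m) ≤
      stripSeq (negRow l) i j ^ 2 :=
  logConcave_stripSeq (negRow_zero_mul_zero_le hl) (negRow_one_mul_one_le_zero hl)
    (negRow_two_mul_two_le_zero hl) (negRow_one_mul_one_le hl)
    (negRow_two_mul_zero_le_one hl) negRow_two_mul_two_le i j k m

set_option maxHeartbeats 2000000 in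
theorem posRow_zero_mul_zero_le {n : ℤ} (hn : 1 ≤ n) (m k : ℤ) :
    posRow n 0 (m + k) * posRow n 0 (m - k) ≤ posRow n 0 m ^ 2 := by
  simp only [posRow_zero]
  split_ifs <;>
    first | omega | (simp only [zero_mul, mul_zero]; positivity) | nlinarith [sq_nonneg k]

set_option maxHeartbeats 2000000 in
theorem posRow_one_mul_one_le_zero {n : ℤ} (hn : 1 ≤ n) (m k : ℤ) :
    posRow n 1 (m + k) * posRow n 1 (m - k - 1) ≤ posRow n 0 m ^ 2 := by
  simp only [posRow_zero, posRow_one]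
  split_ifs <;>
    first | omega | (simp only [zero_mul, mul_zero]; positivity) | nlinarith [sq_nonneg k]

set_option maxHeartbeats 2000000 in
theorem posRow_two_mul_two_le_zero {n : ℤ} (hn : 1 ≤ n) (m k : ℤ) :
    posRow n 2 (m + k) * posRow n 2 (m - k - 2) ≤ posRow n 0 m ^ 2 := by
  simp only [posRow_zero, posRow_two]
  -- for `m = 1`, where the value is `10 n - 10`, the inequality needs `2 ≤ n`
  split_ifs <;>
    first | omega | (simp only [zero_mul, mul_zero]; positivity) |
      nlinarith [sq_nonneg k] |
      (obtain ⟨rfl, rfl⟩ : m = 1 ∧ k = -1 := (by omega)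
       have : 2 ≤ n := (by omega)
       nlinarith)

set_option maxHeartbeats 2000000 in
theorem posRow_one_mul_one_le {n : ℤ} (hn : 1 ≤ n) (m k : ℤ) :
    posRow n 1 (m + k) * posRow n 1 (m - k) ≤ posRow n 1 m ^ 2 := by
  simp only [posRow_one]
  split_ifs <;>
    first | omega | (simp only [zero_mul, mul_zero]; positivity) | nlinarith [sq_nonneg k]

set_option maxHeartbeats 2000000 in
theorem posRow_two_mul_zero_le_one {n : ℤ} (hn : 1 ≤ n) (m k : ℤ) :
    posRow n 2 (m + k) * posRow n 0 (m - k) ≤ posRow n 1 m ^ 2 := by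
  simp only [posRow_zero, posRow_one, posRow_two]
  split_ifs <;>
    first | omega | (simp only [zero_mul, mul_zero]; positivity) | nlinarith [sq_nonneg k]

set_option maxHeartbeats 2000000 in
theorem posRow_two_mul_two_le {n : ℤ} (m k : ℤ) :
    posRow n 2 (m + k) * posRow n 2 (m - k) ≤ posRow n 2 m ^ 2 := by
  simp only [posRow_two]
  split_ifs <;>
    first | omega | (simp only [zero_mul, mul_zero]; positivity) | nlinarith [sq_nonneg k]

theorem logConcave_posRow {n : ℤ} (hn : 1 ≤ n) (i j k m : ℤ) :
    stripSeq (posRow n) (i + k) (j + m) * stripSeq (posRow n) (i - k) (j - m) ≤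
      stripSeq (posRow n) i j ^ 2 :=
  logConcave_stripSeq (posRow_zero_mul_zero_le hn) (posRow_one_mul_one_le_zero hn)
    (posRow_two_mul_two_le_zero hn) (posRow_one_mul_one_le hn)
    (posRow_two_mul_zero_le_one hn) posRow_two_mul_two_le i j k m

/-! ### The coefficients of the explicit polynomials -/

namespace LaurentTwo

theorem coeff_mon_mul (a b : ℤ) (P : LaurentTwo) (i j : ℤ) :
    (mon a b * P).coeff (i, j) = P.coeff (i - a, j - b) := by
  rw [mon, AddMonoidAlgebra.coeff_single_mul_apply, one_mul]
  congr 1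
  ext <;> simp <;> ring

theorem mon_mul_mon (a b c d : ℤ) : mon a b * mon c d = mon (a + c) (b + d) := by
  simp [mon, AddMonoidAlgebra.single_mul_single]

theorem mon_zero_zero : mon 0 0 = 1 := rfl

theorem mon_pow (a b : ℤ) (k : ℕ) : mon a b ^ k = mon (k * a) (k * b) := by
  induction k with
  | zero => simp [mon_zero_zero]
  | succ k ih =>
    rw [pow_succ, ih, mon_mul_mon]
    congr 1 <;> push_cast <;> ring

theorem coeff_mon (a b i j : ℤ) : (mon a b).coeff (i, j) = if i = a ∧ j = b then 1 else 0 := by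
  rw [mon, AddMonoidAlgebra.coeff_single, Finsupp.single_apply]
  simp [Prod.ext_iff, eq_comm]

theorem coeff_intCast_mul (c : ℤ) (P : LaurentTwo) (e : ℤ × ℤ) :
    ((c : LaurentTwo) * P).coeff e = c * P.coeff e := by
  rw [← zsmul_eq_mul, AddMonoidAlgebra.coeff_smul_apply, smul_eq_mul]

/-- The polynomial `∑ c k * (t₀ * t₁) ^ k`, summed over `k < l`. -/
noncomputable def diagSum (l : ℕ) (c : ℤ → ℤ) : LaurentTwo :=
  ∑ k ∈ Finset.range l, (c k : LaurentTwo) * mon k k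

/-- The coefficients of `diagSum l c`. -/
def diagCoeff (l : ℕ) (c : ℤ → ℤ) (m : ℤ) : ℤ := if 0 ≤ m ∧ m < l then c m else 0

theorem coeff_diagSum (l : ℕ) (c : ℤ → ℤ) (i j : ℤ) :
    (diagSum l c).coeff (i, j) = if i = j then diagCoeff l c i else 0 := by
  rw [diagSum, AddMonoidAlgebra.coeff_sum, Finsupp.finsetSum_apply]
  simp only [coeff_intCast_mul, coeff_mon, diagCoeff]
  split_ifs with h1 h2
  · subst h1
    rw [Finset.sum_eq_single i.toNat]
    · rw [Int.toNat_of_nonneg h2.1]; simp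
    · intro k _ hk
      rw [if_neg (by omega), mul_zero]
    · intro h
      exact absurd (Finset.mem_range.2 (by omega)) h
  · refine Finset.sum_eq_zero fun k hk => ?_
    have := Finset.mem_range.1 hk
    rw [if_neg (by omega), mul_zero]
  · refine Finset.sum_eq_zero fun k _ => ?_
    rw [if_neg (by omega), mul_zero]

theorem coeff_mon_mul_diagSum (a b : ℤ) (l : ℕ) (c : ℤ → ℤ) (i j : ℤ) :
    (mon a b * diagSum l c).coeff (i, j) =
      if i - j = a - b then diagCoeff l c (i - a) else 0 := by
  rw [coeff_mon_mul, coeff_diagSum]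
  congr 1
  exact propext ⟨fun h => by omega, fun h => by omega⟩

/-- The polynomial with the terms `c * t₀ ^ a * t₁ ^ b` for `(c, a, b)` in the list. -/
noncomputable def ofTerms (t : List (ℤ × ℤ × ℤ)) : LaurentTwo :=
  (t.map fun x => (x.1 : LaurentTwo) * mon x.2.1 x.2.2).sum

theorem coeff_ofTerms_mul_diagSum (t : List (ℤ × ℤ × ℤ)) (l : ℕ) (c : ℤ → ℤ) (i j : ℤ) :
    (ofTerms t * diagSum l c).coeff (i, j) =
      (t.map fun x => x.1 *
        if i - j = x.2.1 - x.2.2 then diagCoeff l c (i - x.2.1) else 0).sum := by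
  rw [ofTerms]
  induction t with
  | nil => simp
  | cons x t ih =>
    rw [List.map_cons, List.sum_cons, add_mul, AddMonoidAlgebra.coeff_add, Finsupp.add_apply, ih,
      mul_assoc, coeff_intCast_mul, coeff_mon_mul_diagSum, List.map_cons, List.sum_cons]

theorem coeff_ofTerms_mul_mon (t : List (ℤ × ℤ × ℤ)) (m : ℤ) (i j : ℤ) :
    (ofTerms t * mon m m).coeff (i, j) =
      (t.map fun x => x.1 * if i - j = x.2.1 - x.2.2 then (if i = x.2.1 + m then 1 else 0)
        else 0).sum := by
  rw [ofTerms]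
  induction t with
  | nil => simp
  | cons x t ih =>
    rw [List.map_cons, List.sum_cons, add_mul, AddMonoidAlgebra.coeff_add, Finsupp.add_apply, ih,
      mul_assoc, coeff_intCast_mul, mon_mul_mon, coeff_mon, List.map_cons, List.sum_cons]
    congr 2
    split_ifs <;> first | rfl | omega

theorem twistValueNeg_eq (l : ℕ) : twistValueNeg l = 1 +
    ofTerms [(2, 0, 0), (-1, 1, 0), (-1, 0, 1), (-1, -1, 0), (-1, 0, -1), (1, 1, 1), (1, -1, -1)] *
      diagSum l (fun _ => 1) +
    ofTerms LGPoly.negTerms₂ * diagSum l (fun k => 2 * l - 2 * k - 1) := by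
  simp only [twistValueNeg, ofTerms, LGPoly.negTerms₂, diagSum, mon_mul_mon, mon_pow, List.map_cons,
    List.map_nil, List.sum_cons, List.sum_nil]
  push_cast
  simp [mon_zero_zero]
  ring

theorem twistValuePosInv_eq (k : ℕ) : twistValuePosInv (k + 1) =
    ofTerms LGPoly.posTerms₀ * mon k k + ofTerms LGPoly.posTerms₁ * diagSum k (fun _ => 1) +
      ofTerms LGPoly.posTerms₂ * diagSum k (fun j => 2 * k - 2 * j - 1) := by
  have hc : ∀ j : ℕ, 2 * ((k : LaurentTwo) + 1) - 2 * j - 3 = 2 * (k : LaurentTwo) - 2 * j - 1 :=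
    fun j => by ring
  have h11 : mon 1 0 * mon 0 1 = mon 1 1 := mon_mul_mon 1 0 0 1
  have h20 : mon 1 0 ^ 2 = mon 2 0 := mon_pow 1 0 2
  have h02 : mon 0 1 ^ 2 = mon 0 2 := mon_pow 0 1 2
  have h21 : mon 2 1 = mon 2 0 * mon 0 1 := (mon_mul_mon 2 0 0 1).symm
  have h12 : mon 1 2 = mon 1 0 * mon 0 2 := (mon_mul_mon 1 0 0 2).symm
  have h22 : mon 2 2 = mon 2 0 * mon 0 2 := (mon_mul_mon 2 0 0 2).symm
  have hkk : ∀ j : ℕ, mon j j = (mon 1 0 * mon 0 1) ^ j := fun j => by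
    rw [h11, mon_pow, mul_one]
  simp only [twistValuePosInv, ofTerms, LGPoly.posTerms₀, LGPoly.posTerms₁, LGPoly.posTerms₂,
    diagSum, hkk, h21, h12, h22, ← h11, ← h20, ← h02, mon_zero_zero, List.map_cons, List.map_nil,
    List.sum_cons, List.sum_nil, Nat.add_sub_cancel]
  push_cast
  simp only [hc]
  ring_nf

theorem coeff_twistValueNeg {l : ℕ} (hl : 1 ≤ l) (i j : ℤ) :
    (twistValueNeg l).coeff (i, j) =
      if Even (i + j) then stripSeq (negRow l) i j else -stripSeq (negRow l) i j := by
  have hone : (1 : LaurentTwo).coeff (i, j) = if i = 0 ∧ j = 0 then 1 else 0 := by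
    rw [← mon_zero_zero, coeff_mon]
  rw [twistValueNeg_eq, AddMonoidAlgebra.coeff_add, AddMonoidAlgebra.coeff_add, Finsupp.add_apply,
    Finsupp.add_apply, coeff_ofTerms_mul_diagSum, coeff_ofTerms_mul_diagSum, hone]
  simp only [LGPoly.negTerms₂, List.map_cons, List.map_nil, List.sum_cons, List.sum_nil,
    Int.even_iff, diagCoeff]
  have hd : i - j = -2 ∨ i - j = -1 ∨ i - j = 0 ∨ i - j = 1 ∨ i - j = 2 ∨ 2 < |i - j| := by
    grind
  rcases hd with hd | hd | hd | hd | hd | hd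
  · rw [stripSeq_two' _ (m := i) rfl (by omega), negRow_two]
    simp only [hd]; norm_num
    omega
  · rw [stripSeq_one' _ (m := i) rfl (by omega), negRow_one]
    simp only [hd]; norm_num
    omega
  · rw [stripSeq_zero _ (m := i) rfl (by omega), negRow_zero]
    simp only [hd]; norm_num
    omega
  · rw [stripSeq_one _ (m := j) (by omega) rfl, negRow_one]
    simp only [hd]; norm_num
    omega
  · rw [stripSeq_two _ (m := j) (by omega) rfl, negRow_two]
    simp only [hd]; norm_num
    omega
  · rw [stripSeq_eq_zero _ hd]
    have hne : ∀ c : ℤ, |c| ≤ 2 → i - j ≠ c := by grind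
    have h0 : ¬(i = 0 ∧ j = 0) := fun h => hne 0 (by norm_num) (by rw [h.1, h.2]; norm_num)
    norm_num [hne, h0]

theorem coeff_twistValuePosInv (k : ℕ) (i j : ℤ) :
    (twistValuePosInv (k + 1)).coeff (i, j) =
      if Even (i + j) then stripSeq (posRow (k + 1)) i j else -stripSeq (posRow (k + 1)) i j := by
  rw [twistValuePosInv_eq, AddMonoidAlgebra.coeff_add, AddMonoidAlgebra.coeff_add,
    Finsupp.add_apply, Finsupp.add_apply, coeff_ofTerms_mul_diagSum, coeff_ofTerms_mul_diagSum,
    coeff_ofTerms_mul_mon]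
  simp only [LGPoly.posTerms₀, LGPoly.posTerms₁, LGPoly.posTerms₂, List.map_cons, List.map_nil,
    List.sum_cons, List.sum_nil, Int.even_iff, diagCoeff]
  have hd : i - j = -2 ∨ i - j = -1 ∨ i - j = 0 ∨ i - j = 1 ∨ i - j = 2 ∨ 2 < |i - j| := by
    grind
  rcases hd with hd | hd | hd | hd | hd | hd
  · rw [stripSeq_two' _ (m := i) rfl (by omega), posRow_two]
    simp only [hd]; norm_num
    omega
  · rw [stripSeq_one' _ (m := i) rfl (by omega), posRow_one]
    simp only [hd]; norm_num
    omega
  · rw [stripSeq_zero _ (m := i) rfl (by omega), posRow_zero]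
    simp only [hd]; norm_num
    omega
  · rw [stripSeq_one _ (m := j) (by omega) rfl, posRow_one]
    simp only [hd]; norm_num
    omega
  · rw [stripSeq_two _ (m := j) (by omega) rfl, posRow_two]
    simp only [hd]; norm_num
    omega
  · rw [stripSeq_eq_zero _ hd]
    have hne : ∀ c : ℤ, |c| ≤ 2 → i - j ≠ c := by grind
    norm_num [hne]

end LaurentTwo

/-! ### The properties of the coefficients -/

namespace LaurentTwo.IsConcaveAlternating

/-- A chessboard of signs on a non-negative sequence `b` with both concavity properties. -/
theorem of_coeff {P : LaurentTwo} {b : ℤ → ℤ → ℤ}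
    (hP : ∀ i j, P.coeff (i, j) = if Even (i + j) then b i j else -b i j) (hb : ∀ i j, 0 ≤ b i j)
    (hquasi : QuasiConcave b)
    (hlog : ∀ i j k l, b (i + k) (j + l) * b (i - k) (j - l) ≤ b i j ^ 2) :
    P.IsConcaveAlternating := by
  have habs : ∀ i j, |P.coeff (i, j)| = b i j := fun i j => by
    rw [hP]
    split_ifs
    · exact abs_of_nonneg (hb i j)
    · rw [abs_neg, abs_of_nonneg (hb i j)]
  constructor
  · intro i j hij
    rw [hP, if_pos hij]
    exact hb i j
  · intro i j hij
    rw [hP, if_neg hij]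
    exact neg_nonpos.2 (hb i j)
  · simpa only [habs] using hquasi
  · simpa only [habs] using hlog

theorem one : IsConcaveAlternating 1 := by
  refine of_coeff (b := fun i j => if i = 0 ∧ j = 0 then 1 else 0) (fun i j => ?_) (fun i j => ?_)
    (fun i j => ?_) (fun i j k l => ?_)
  · rw [← mon_zero_zero, coeff_mon]
    split_ifs with h1 h2 h2
    · rfl
    · exact absurd (by simp [h1]) h2
    · rfl
    · rfl
  · split_ifs <;> norm_num
  · refine ⟨i + j, i - j, fun i' j' hlt => ?_⟩
    dsimp only at hlt
    split_ifs at hlt with h1 h2 h2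
    · omega
    · omega
    · obtain ⟨rfl, rfl⟩ := h2
      have : i + j ≠ 0 ∨ i - j ≠ 0 := by omega
      rcases this with h | h
      · nlinarith [sq_nonneg (i - j), (sq_pos_of_ne_zero h : 0 < (i + j) ^ 2)]
      · nlinarith [sq_nonneg (i + j), (sq_pos_of_ne_zero h : 0 < (i - j) ^ 2)]
    · omega
  · split_ifs <;> omega

theorem twistValueNeg (l : ℕ) : (twistValueNeg l).IsConcaveAlternating := by
  rcases Nat.eq_zero_or_pos l with rfl | hl
  · have h : _root_.twistValueNeg 0 = 1 := by simp [_root_.twistValueNeg]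
    rw [h]
    exact one
  · have hl' : (1 : ℤ) ≤ l := by exact_mod_cast hl
    exact of_coeff (coeff_twistValueNeg hl) (stripSeq_nonneg (negRow_nonneg hl'))
      (quasiConcave_negRow hl') (logConcave_negRow hl')

theorem twistValuePosInv (k : ℕ) : (twistValuePosInv (k + 1)).IsConcaveAlternating := by
  have hk : (1 : ℤ) ≤ k + 1 := by omega
  exact of_coeff (coeff_twistValuePosInv k) (stripSeq_nonneg (posRow_nonneg hk))
    (quasiConcave_posRow hk) (logConcave_posRow hk)

end LaurentTwo.IsConcaveAlternating

theorem mainTheorem4 :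
    linksGould (Tangle.twistKnot 0) = 1 ∧
    (∀ l : ℕ, 1 ≤ l → linksGould (Tangle.twistKnot (-(l : ℤ))) = twistValueNeg l) ∧
    (∀ n : ℕ, 1 ≤ n →
      (linksGould (Tangle.twistKnot (n : ℤ))).invertVars = twistValuePosInv n) ∧
    ∀ n : ℤ, ∀ T : Tangle [up] [up],
      (T = Tangle.twistKnot n ∨ T = (Tangle.twistKnot n).mirror) →
        IsLinksGould T (linksGould T) ∧
        Alternates 1 (linksGould T).coeffSeq ∧
        NoInteriorZeros (linksGould T).coeffSeq ∧
        TwoDLogConcave (linksGould T).absSeq ∧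
        NoInteriorZeros (linksGould T).absSeq ∧
        Unimodal (linksGould T).absSeq := by
  have hneg : ∀ l : ℕ, linksGould (Tangle.twistKnot (-(l : ℤ))) = twistValueNeg l := fun l => by
    rw [twistKnot_neg]
    exact (isLinksGould_cross_crossInv l).linksGould_eq
  refine ⟨?_, fun l _ => hneg l, fun n hn => ?_, fun n T hT => ?_⟩
  · have h := hneg 0
    rw [Nat.cast_zero, neg_zero] at h
    rw [h]
    simp [twistValueNeg]
  · obtain ⟨k, rfl⟩ := Nat.exists_eq_add_of_le' hn
    rw [twistKnot_pos, (isLinksGould_crossInv_crossInv k).linksGould_eq,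
      LaurentTwo.invertVars_invertVars]
  · obtain ⟨P, hTP, hP⟩ := isLinksGould_twistKnot_cases hT
    have hconc : P.IsConcaveAlternating := by
      rcases hP with ⟨l, rfl⟩ | ⟨k, rfl⟩
      · exact .twistValueNeg l
      · exact .twistValuePosInv k
    obtain ⟨Q, hTQ, hQ⟩ : ∃ Q, IsLinksGould T Q ∧ Q.IsConcaveAlternating :=
      hTP.elim (fun h => ⟨P, h, hconc⟩) fun h => ⟨_, h, hconc.invertVars⟩
    rw [hTQ.linksGould_eq]
    exact ⟨hTQ, hQ.alternates, hQ.noInteriorZeros fun _ _ => rfl, hQ.twoDLogConcave,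
      hQ.noInteriorZeros fun _ _ => abs_abs _,
      fun c _ => hQ.noInteriorZeros_truncation (fun _ _ => abs_abs _) c⟩
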